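/- A \emph{pseudoline} is the image of a line under a homeomorphism of the plane. In a \emph{simple pseudoline arrangement} finitely many pseudolines are given, every two of which intersect in exactly one point, where they cross (locally, up to homeomorphism, like two crossing lines), and no point lies on three of them. A \emph{pseudoline arrangement graph} is a graph isomorphic to one whose vertices are the crossings of a simple pseudoline arrangement and whose edges connect consecutive crossings on a common pseudoline; if there are $\ell$ pseudolines, it has $n=\ell(\ell-1)/2$ vertices. A \emph{wiring diagram} of $\ell$ pseudolines is a sequence of crossings, in left-to-right order, each of which swaps the pseudolines on two adjacent ones of $\ell$ horizontal tracks, such that every two pseudolines cross exactly once. Let $\kappa_{\max}(\ell)$ be the maximum, over all wiring diagrams of $\ell$ pseudolines and all $1\le i<\ell$, of the number of crossings between tracks $i$ and $i+1$ (with $\kappa_{\max}(\ell)=0$ for $\ell\le 1$). Let $\xi_i=i\oplus(i-1)$ for $i\ge1$, where $\oplus$ is bitwise exclusive or. Theorem. There are finite sets $U_n$ ($n\ge 0$) of points in the plane with nonnegative integer coordinates such that: (1) for every $n$, the set $U_n$ is a universal point set for the $n$-vertex pseudoline arrangement graphs: every such graph has a planar straight-line drawing (distinct vertices at distinct points, edges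 drawn as straight segments that meet only at common endpoints and contain no other vertices) with all its vertices placed at points of $U_n$; (2) $|U_n|=O(n\log n)$ as $n\to\infty$; (3) whenever $n=\ell(\ell-1)/2$ for an integer $\ell\ge0$, the set $U_n$ is contained in the grid $\{1,\dots,\kappa_{\max}(\ell)\}\times\{1,\dots,s\}$ with $s=\lfloor 3(\ell-1)/2\rfloor=O(\ell)$ rows (read $s=0$ if $\ell=0$), and for each $1\le i\le s$ its $i$-th row contains exactly $\min(\ell\,\xi_i,\kappa_{\max}(\ell))$ points of $U_n$. -/

import Mathlib

open Set Filter Asymptotics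

/-! ### Pseudolines, arrangements and arrangement graphs -/

/-- The horizontal axis of the plane, as a model line. -/
def horizontalAxis : Set (ℝ × ℝ) := {p | p.2 = 0}

/-- A pseudoline is the image of a line under a homeomorphism of the plane. (All lines are
equivalent under homeomorphisms of the plane, so it suffices to take images of one line.) -/
def IsPseudoline (S : Set (ℝ × ℝ)) : Prop :=
  ∃ h : (ℝ × ℝ) ≃ₜ (ℝ × ℝ), h '' horizontalAxis = S

/-- The point `x` is a crossing of `A` and `B`: some neighborhood of `x` can be mapped
homeomorphically to a neighborhood of the crossing point of two lines (without loss of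
generality the two coordinate axes, crossing at the origin), such that within this neighborhood
`A` and `B` are taken to the two lines. -/
def IsCrossing (A B : Set (ℝ × ℝ)) (x : ℝ × ℝ) : Prop :=
  ∃ φ : OpenPartialHomeomorph (ℝ × ℝ) (ℝ × ℝ),
    x ∈ φ.source ∧ φ x = (0, 0) ∧
      ∀ p ∈ φ.source, (p ∈ A ↔ (φ p).2 = 0) ∧ (p ∈ B ↔ (φ p).1 = 0)

/-- A simple arrangement of `ℓ` pseudolines: any two of them intersect in exactly one point, which
is a crossing, and different pairs have different crossing points, that is, no point lies on three
of the pseudolines. -/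
structure IsSimpleArrangement {ℓ : ℕ} (L : Fin ℓ → Set (ℝ × ℝ)) : Prop where
  pseudoline : ∀ i, IsPseudoline (L i)
  crossing : ∀ i j, i ≠ j → ∃ x, L i ∩ L j = {x} ∧ IsCrossing (L i) (L j) x
  simple : ∀ i j k, i ≠ j → i ≠ k → j ≠ k → L i ∩ L j ∩ L k = ∅

/-- The set of crossing points of a family of curves. -/
def crossingPoints {ℓ : ℕ} (L : Fin ℓ → Set (ℝ × ℝ)) : Set (ℝ × ℝ) :=
  {p | ∃ i j, i ≠ j ∧ p ∈ L i ∧ p ∈ L j}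

/-- The graph of an arrangement: its vertices are the crossings, and its edges connect consecutive
crossings on a common pseudoline, i.e. two crossings such that no further crossing lies strictly
between them along that pseudoline. -/
def arrangementGraph {ℓ : ℕ} (L : Fin ℓ → Set (ℝ × ℝ)) : SimpleGraph (crossingPoints L) where
  Adj p q := p ≠ q ∧ ∃ (i : Fin ℓ) (h : (ℝ × ℝ) ≃ₜ (ℝ × ℝ)) (a b : ℝ),
    h '' horizontalAxis = L i ∧ h (a, 0) = p ∧ h (b, 0) = q ∧
      ∀ t ∈ uIoo a b, h (t, 0) ∉ crossingPoints L
  symm := ⟨by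
    rintro p q ⟨hpq, i, h, a, b, hL, ha, hb, hab⟩
    exact ⟨hpq.symm, i, h, b, a, hL, hb, ha, by rwa [uIoo_comm]⟩⟩
  loopless := ⟨fun _ hp => hp.1 rfl⟩

/-- A pseudoline arrangement graph is a graph isomorphic to the graph of some simple pseudoline
arrangement. -/
def IsArrangementGraph {V : Type*} (G : SimpleGraph V) : Prop :=
  ∃ (ℓ : ℕ) (L : Fin ℓ → Set (ℝ × ℝ)),
    IsSimpleArrangement L ∧ Nonempty (G ≃g arrangementGraph L)

/-! ### Straight-line drawings and universal point sets -/

/-- A planar straight-line drawing: vertices are placed at distinct points, no vertex lies on an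
edge other than as one of its endpoints, and distinct edges do not meet except at common
endpoints. -/
structure IsPlanarStraightLineDrawing {V : Type*} (G : SimpleGraph V) (f : V → ℝ × ℝ) : Prop where
  injective : Function.Injective f
  vertex_edge : ∀ u v w, G.Adj u v → f w ∈ segment ℝ (f u) (f v) → w = u ∨ w = v
  edge_edge : ∀ u v x y, G.Adj u v → G.Adj x y → s(u, v) ≠ s(x, y) →
    Disjoint (openSegment ℝ (f u) (f v)) (openSegment ℝ (f x) (f y))

/-- `P` is a universal point set for the `n`-vertex graphs in the class `C`. -/
def IsUniversalPointSet {n : ℕ} (C : SimpleGraph (Fin n) → Prop) (P : Set (ℝ × ℝ)) : Prop :=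
  ∀ G, C G → ∃ f : Fin n → ℝ × ℝ, (∀ v, f v ∈ P) ∧ IsPlanarStraightLineDrawing G f

/-- The point of the plane with the given natural coordinates. -/
def gridPoint (p : ℕ × ℕ) : ℝ × ℝ := ((p.1 : ℝ), (p.2 : ℝ))

/-! ### Wiring diagrams and level complexity -/

/-- The lower one of the two tracks that meet in the level `t` (tracks and levels are numbered
from `0`, and level `t` is the one between the tracks `t` and `t + 1`). -/
def lowerTrack {ℓ : ℕ} (t : Fin (ℓ - 1)) : Fin ℓ := ⟨t, by omega⟩

/-- The upper one of the two tracks that meet in the level `t`. -/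
def upperTrack {ℓ : ℕ} (t : Fin (ℓ - 1)) : Fin ℓ := ⟨t + 1, by omega⟩

/-- The assignment of pseudolines to tracks after the crossings in the levels `w`, read from left to
right: `trackOccupant w t` is the pseudoline that then lies on track `t`. Initially pseudoline `t`
lies on track `t`, and each crossing swaps the pseudolines on the two tracks of its level. -/
def trackOccupant {ℓ : ℕ} (w : List (Fin (ℓ - 1))) : Equiv.Perm (Fin ℓ) :=
  (w.map fun t => Equiv.swap (lowerTrack t) (upperTrack t)).prod

/-- The two pseudolines that meet in the `k`-th crossing (from the left). -/
def crossingPair {ℓ : ℕ} (w : List (Fin (ℓ - 1))) (k : Fin w.length) : Sym2 (Fin ℓ) :=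
  s(trackOccupant (w.take k) (lowerTrack (w.get k)),
    trackOccupant (w.take k) (upperTrack (w.get k)))

/-- A wiring diagram of `ℓ` pseudolines, given by the left-to-right sequence of the levels of its
crossings; every two pseudolines cross exactly once. -/
structure WiringDiagram (ℓ : ℕ) where
  levels : List (Fin (ℓ - 1))
  cross_once : ∀ i j : Fin ℓ, i ≠ j → ∃! k : Fin levels.length, crossingPair levels k = s(i, j)

/-- The level complexity of a wiring diagram: the maximum number of crossings in a level. -/
def WiringDiagram.complexity {ℓ : ℕ} (D : WiringDiagram ℓ) : ℕ :=
  Finset.univ.sup fun t : Fin (ℓ - 1) => D.levels.count t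

/-- The maximum level complexity of a wiring diagram of `ℓ` pseudolines. -/
noncomputable def kappaMax (ℓ : ℕ) : ℕ := ⨆ D : WiringDiagram ℓ, D.complexity

/-- The level complexities are bounded, so that the supremum in `kappaMax` is a maximum. -/
theorem bddAbove_complexity (ℓ : ℕ) :
    BddAbove (range fun D : WiringDiagram ℓ => D.complexity) := by
  refine ⟨Fintype.card (Sym2 (Fin ℓ)), ?_⟩
  rintro _ ⟨D, rfl⟩
  have hinj : Function.Injective (crossingPair D.levels) := by
    intro k k' hkk
    have hne : trackOccupant (D.levels.take k) (lowerTrack (D.levels.get k)) ≠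
        trackOccupant (D.levels.take k) (upperTrack (D.levels.get k)) := by
      intro h
      have := congrArg Fin.val ((trackOccupant (D.levels.take k)).injective h)
      simp [lowerTrack, upperTrack] at this
    exact (D.cross_once _ _ hne).unique rfl hkk.symm
  have hlen : D.levels.length ≤ Fintype.card (Sym2 (Fin ℓ)) := by
    simpa using Fintype.card_le_of_injective _ hinj
  exact Finset.sup_le fun t _ => List.count_le_length.trans hlen

/-- The sequence `1, 3, 1, 7, 1, 3, 1, 15, …` (for `i = 1, 2, 3, …`), where `^^^` is the bitwise
exclusive or. -/
def xiSeq (i : ℕ) : ℕ := i ^^^ (i - 1)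

/-! An arrangement is first made combinatorial. At a crossing a pseudoline changes sides of the
other one, so the crossing of `i` and `j` lies on a side of `k` that can be read off along `i` or
along `j`. The agreement of the two readings (`IsSimpleArrangement.exists_parameters`) is all that
is kept of the topology. Fix one pseudoline `z` and flip directions and sides so that `z` crosses
all others in the same sense. Then "`i` crosses `j` upwards" is a strict total order, and in the
resulting labeling the three crossings of any `i < j < k` come in the order `ij, ik, jk` or in the
reverse order (`exists_consistent_labeling`). Inserting the pseudolines one by one merges these
local orders into a single linear order of all crossings (`exists_linear_extension`), that is, a
left-to-right sweep, and hence a wiring diagram.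

The crossings of each level are then drawn from left to right in a row of their own, with higher
levels in higher rows. Consecutive crossings on a pseudoline are joined along one track, so an edge
stays in a level or connects adjacent levels. The edges along one track are ordered by time, so they
do not cross when drawn straight (`isPlanarStraightLineDrawing_levelPoint`).

It remains to fit the levels into prescribed rows. If level `t` has `c t` crossings, it needs a row
`i` with `ℓ * ξ i ≥ c t`. Demands `d t = c t / ℓ + 1` can be met by increasing row indices bounded
by their partial sums, because every `2 ^ k` consecutive indices include a multiple of `2 ^ k`,
whose `ξ` is at least `2 ^ (k + 1) - 1` (`exists_strictMono_le_xiSeq`). As the `c t` add up to `ℓ *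
(ℓ - 1) / 2`, the demands add up to at most `3 * (ℓ - 1) / 2`. The sum of the first `m` terms of `ξ`
is `O(m log m)`, so the rows hold `O(ℓ * ℓ log ℓ) = O(n log n)` points. -/

/-! ### Topology: sides of pseudolines and changes of side at crossings. -/

theorem mem_image_horizontalAxis {S : Set (ℝ × ℝ)} {h : (ℝ × ℝ) ≃ₜ (ℝ × ℝ)}
    (hS : h '' horizontalAxis = S) (p : ℝ × ℝ) : p ∈ S ↔ (h.symm p).2 = 0 := by
  subst hS
  constructor
  · rintro ⟨q, hq, rfl⟩
    simpa [horizontalAxis] using hq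
  · intro hp
    exact ⟨h.symm p, hp, by simp⟩

/-- A continuous function without zeros on a preconnected set keeps its sign there. -/
theorem IsPreconnected.pos_iff_pos_of_ne_zero {X : Type*} [TopologicalSpace X] {s : Set X}
    (hs : IsPreconnected s) {g : X → ℝ} (hg : ContinuousOn g s) (h0 : ∀ x ∈ s, g x ≠ 0)
    {x y : X} (hx : x ∈ s) (hy : y ∈ s) : 0 < g x ↔ 0 < g y := by
  have key : ∀ x ∈ s, ∀ y ∈ s, 0 < g x → 0 < g y := by
    intro x hx y hy hpos
    by_contra hy0
    obtain ⟨z, hz, hz0⟩ := hs.intermediate_value hy hx hg ⟨not_lt.1 hy0, hpos.le⟩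
    exact h0 z hz hz0
  exact ⟨key x hx y hy, key y hy x hx⟩

/-- At a crossing of `A` with the zero set of `g`, the set `A` meets every side of the zero set that
accumulates at the crossing. -/
theorem IsCrossing.exists_pos {A B : Set (ℝ × ℝ)} {x : ℝ × ℝ} (hx : IsCrossing A B x)
    {g : ℝ × ℝ → ℝ} (hg : Continuous g) (hB : ∀ p, p ∈ B ↔ g p = 0)
    (hcl : ∃ᶠ p in nhds x, 0 < g p) : ∃ p ∈ A, 0 < g p := by
  obtain ⟨φ, hxs, hφx, hφ⟩ := hx
  by_contra! hA
  have htarget : φ.target ∈ nhds ((0, 0) : ℝ × ℝ) :=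
    φ.open_target.mem_nhds (hφx ▸ φ.map_source hxs)
  obtain ⟨r, hr, hball⟩ := Metric.mem_nhds_iff.1 htarget
  have hbox : ∀ a b : ℝ, |a| < r → |b| < r → (a, b) ∈ φ.target := by
    intro a b ha hb
    apply hball
    simp [Prod.dist_eq, ha, hb]
  -- In the chart, a half of the box off `B` is connected and `g` has no zero there, so `g` keeps
  -- the sign that it has at the points `(a, 0)` of `A`.
  have hside : ∀ I : Set ℝ, Convex ℝ I → (∀ a ∈ I, a ≠ 0 ∧ |a| < r) →
      ∀ a ∈ I, ∀ b, |b| < r → g (φ.symm (a, b)) ≤ 0 := by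
    intro I hI hI0 a ha b hb
    have hconv : Convex ℝ (I ×ˢ Ioo (-r) r) := hI.prod (convex_Ioo _ _)
    have hsub : I ×ˢ Ioo (-r) r ⊆ φ.target := fun q hq =>
      hbox q.1 q.2 (hI0 _ hq.1).2 (abs_lt.2 hq.2)
    have hne : ∀ q ∈ I ×ˢ Ioo (-r) r, (g ∘ φ.symm) q ≠ 0 := by
      intro q hq h0
      have hs := φ.map_target (hsub hq)
      have := (hφ _ hs).2.1 ((hB _).2 h0)
      rw [φ.right_inv (hsub hq)] at this
      exact (hI0 _ hq.1).1 this
    have hcont : ContinuousOn (g ∘ φ.symm) (I ×ˢ Ioo (-r) r) :=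
      hg.comp_continuousOn (φ.continuousOn_symm.mono hsub)
    have h0mem : (a, (0 : ℝ)) ∈ I ×ˢ Ioo (-r) r := ⟨ha, by constructor <;> linarith⟩
    have hA0 : φ.symm (a, 0) ∈ A := by
      refine (hφ _ (φ.map_target (hsub h0mem))).1.2 ?_
      rw [φ.right_inv (hsub h0mem)]
    have := hconv.isPreconnected.pos_iff_pos_of_ne_zero hcont hne h0mem
      (show (a, b) ∈ I ×ˢ Ioo (-r) r from ⟨ha, abs_lt.1 hb⟩)
    by_contra! hpos
    exact absurd (hA _ hA0) (not_le.2 (this.2 hpos))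
  have hnear : ∀ᶠ p in nhds x, p ∈ φ.source ∧ φ p ∈ Metric.ball ((0, 0) : ℝ × ℝ) r := by
    refine Filter.Eventually.and (φ.open_source.mem_nhds hxs) ?_
    have := φ.continuousAt hxs
    rw [ContinuousAt, hφx] at this
    exact this (Metric.ball_mem_nhds _ hr)
  obtain ⟨p, hpos, hps, hpb⟩ := (hcl.and_eventually hnear).exists
  have hp : φ.symm ((φ p).1, (φ p).2) = p := φ.left_inv hps
  simp only [Metric.mem_ball, Prod.dist_eq, dist_zero_right, Real.norm_eq_abs, sup_lt_iff] at hpb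
  rcases lt_trichotomy (φ p).1 0 with h | h | h
  · have := hside (Ioo (-r) 0) (convex_Ioo _ _)
      (fun a ha => ⟨ha.2.ne, abs_lt.2 ⟨ha.1, ha.2.trans hr⟩⟩) _ ⟨(abs_lt.1 hpb.1).1, h⟩ _ hpb.2
    rw [hp] at this
    exact absurd this (not_le.2 hpos)
  · have := (hB p).1 ((hφ p hps).2.2 h)
    exact hpos.ne' this
  · have := hside (Ioo 0 r) (convex_Ioo _ _)
      (fun a ha => ⟨ha.1.ne', abs_lt.2 ⟨by linarith [ha.1], ha.2⟩⟩) _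
      ⟨h, (abs_lt.1 hpb.1).2⟩ _ hpb.2
    rw [hp] at this
    exact absurd this (not_le.2 hpos)

/-- A continuous real function with a unique zero and both signs changes its sign at the zero. -/
theorem exists_pos_iff_of_unique_zero {f : ℝ → ℝ} (hf : Continuous f) {c : ℝ}
    (hc : ∀ x, f x = 0 ↔ x = c) (hpos : ∃ x, 0 < f x) (hneg : ∃ x, f x < 0) :
    ∃ P : Prop, ∀ x, x ≠ c → (0 < f x ↔ (P ↔ c < x)) := by
  refine ⟨0 < f (c + 1), fun x hx => ?_⟩
  have hright : ∀ x, c < x → (0 < f x ↔ 0 < f (c + 1)) := fun x hx =>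
    isPreconnected_Ioi.pos_iff_pos_of_ne_zero hf.continuousOn
      (fun y (hy : c < y) h0 => hy.ne' ((hc y).1 h0)) hx (show c < c + 1 by linarith)
  have hleft : ∀ x, x < c → (0 < f x ↔ 0 < f (c - 1)) := fun x hx =>
    isPreconnected_Iio.pos_iff_pos_of_ne_zero hf.continuousOn
      (fun y (hy : y < c) h0 => hy.ne ((hc y).1 h0)) hx (show c - 1 < c by linarith)
  have hopp : 0 < f (c - 1) ↔ ¬ 0 < f (c + 1) := by
    obtain ⟨a, ha⟩ := hpos
    obtain ⟨b, hb⟩ := hneg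
    have hb' : ¬ 0 < f b := hb.le.not_gt
    have hac : a ≠ c := fun h => ha.ne' ((hc a).2 h)
    have hbc : b ≠ c := fun h => hb.ne ((hc b).2 h)
    rcases lt_or_gt_of_ne hac with h | h <;> rcases lt_or_gt_of_ne hbc with h' | h'
    · exact absurd ((hleft b h').2 ((hleft a h).1 ha)) hb'
    · have h1 := (hleft a h).1 ha
      have h2 := fun h => hb' ((hright b h').2 h)
      tauto
    · have h1 := (hright a h).1 ha
      have h2 := fun h => hb' ((hleft b h').2 h)
      tauto
    · exact absurd ((hright b h').2 ((hright a h).1 ha)) hb'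
  rcases lt_or_gt_of_ne hx with h | h
  · rw [hleft x h, hopp]
    simp [h.not_gt]
  · rw [hright x h]
    simp [h]

/-- Parametrizing each pseudoline of a simple arrangement by `x ↦ h i (x, 0)`, the parameters `t i j`
of the crossings and the directions `P i k` in which the sides of `L k` are changed by `L i`
determine on which side of `L k` the crossing of `L i` and `L j` lies, in two ways that agree. -/
theorem IsSimpleArrangement.exists_parameters {ℓ : ℕ} {L : Fin ℓ → Set (ℝ × ℝ)}
    (hL : IsSimpleArrangement L) :
    ∃ (h : Fin ℓ → (ℝ × ℝ) ≃ₜ (ℝ × ℝ)) (t : Fin ℓ → Fin ℓ → ℝ) (P : Fin ℓ → Fin ℓ → Prop),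
      (∀ i, h i '' horizontalAxis = L i) ∧
      (∀ i j, i ≠ j → ∀ x, h i (x, 0) ∈ L j ↔ x = t i j) ∧
      (∀ i j, i ≠ j → h i (t i j, 0) = h j (t j i, 0)) ∧
      (∀ i j k, i ≠ j → i ≠ k → j ≠ k → t i j ≠ t i k) ∧
      ∀ i j k, i ≠ j → i ≠ k → j ≠ k →
        ((P i k ↔ t i k < t i j) ↔ (P j k ↔ t j k < t j i)) := by
  choose h hh using hL.pseudoline
  have hmem : ∀ i (x : ℝ), h i (x, 0) ∈ L i := fun i x => by
    rw [← hh i]; exact mem_image_of_mem _ rfl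
  have hpar : ∀ i, ∀ p ∈ L i, h i (((h i).symm p).1, 0) = p := by
    intro i p hp
    have := (mem_image_horizontalAxis (hh i) p).1 hp
    rw [← this]
    simp
  -- The condition `i ≠ j` stands inside the existential so that `choose` gives a total function;
  -- its diagonal values are junk.
  have hex : ∀ i j, ∃ c : ℝ, i ≠ j →
      L i ∩ L j = {h i (c, 0)} ∧ IsCrossing (L i) (L j) (h i (c, 0)) := by
    intro i j
    by_cases hij : i = j
    · exact ⟨0, fun hne => absurd hij hne⟩
    · obtain ⟨x, hx, hcr⟩ := hL.crossing i j hij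
      have hxm : x ∈ L i ∩ L j := hx ▸ mem_singleton x
      refine ⟨((h i).symm x).1, fun _ => ?_⟩
      rw [hpar i x hxm.1]
      exact ⟨hx, hcr⟩
  choose t ht using hex
  have hmem_iff : ∀ i j, i ≠ j → ∀ x, h i (x, 0) ∈ L j ↔ x = t i j := by
    intro i j hij x
    constructor
    · intro hx
      have : h i (x, 0) ∈ L i ∩ L j := ⟨hmem i x, hx⟩
      rw [(ht i j hij).1] at this
      simpa using (h i).injective this
    · rintro rfl
      have : h i (t i j, 0) ∈ L i ∩ L j := by rw [(ht i j hij).1]; rfl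
      exact this.2
  have heq : ∀ i j, i ≠ j → h i (t i j, 0) = h j (t j i, 0) := by
    intro i j hij
    have : h i (t i j, 0) ∈ L j ∩ L i := ⟨(hmem_iff i j hij _).2 rfl, hmem i _⟩
    rw [(ht j i hij.symm).1] at this
    exact this
  have hne : ∀ i j k, i ≠ j → i ≠ k → j ≠ k → t i j ≠ t i k := by
    intro i j k hij hik hjk heq'
    have : h i (t i j, 0) ∈ L i ∩ L j ∩ L k :=
      ⟨⟨hmem i _, (hmem_iff i j hij _).2 rfl⟩, (hmem_iff i k hik _).2 heq'⟩
    rw [hL.simple i j k hij hik hjk] at this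
    exact this
  have hsign : ∀ i k, ∃ P : Prop, i ≠ k → ∀ x, x ≠ t i k →
      (0 < ((h k).symm (h i (x, 0))).2 ↔ (P ↔ t i k < x)) := by
    intro i k
    by_cases hik : i = k
    · exact ⟨True, fun hne => absurd hik hne⟩
    have hcg : Continuous fun p => ((h k).symm p).2 := continuous_snd.comp (h k).symm.continuous
    have hzero := mem_image_horizontalAxis (hh k)
    have hcr := (ht i k hik).2
    rw [heq i k hik] at hcr
    -- In the coordinates of `h k`, the vertical line through the crossing shows that both sides of
    -- `L k` accumulate there.
    have hfreq : ∀ S : Set ℝ, (∃ᶠ d in nhds (0 : ℝ), d ∈ S) →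
        ∃ᶠ p in nhds (h k (t k i, 0)), ((h k).symm p).2 ∈ S := by
      intro S hS
      have hcont : Tendsto (fun d : ℝ => h k (t k i, d)) (nhds 0) (nhds (h k (t k i, 0))) := by
        apply Continuous.tendsto
        fun_prop
      exact hcont.frequently (by simpa using hS)
    have hpos : ∃ p ∈ L i, 0 < ((h k).symm p).2 := by
      refine hcr.exists_pos hcg hzero (hfreq (Ioi 0) ?_)
      exact mem_closure_iff_frequently.1 (by simp)
    have hneg : ∃ p ∈ L i, 0 < -((h k).symm p).2 := by
      refine hcr.exists_pos (g := fun p => -((h k).symm p).2) hcg.neg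
        (fun p => by rw [hzero p, neg_eq_zero]) ?_
      simp only [Left.neg_pos_iff]
      exact hfreq (Iio 0) (mem_closure_iff_frequently.1 (by simp))
    obtain ⟨p, hp, hp0⟩ := hpos
    obtain ⟨q, hq, hq0⟩ := hneg
    obtain ⟨P, hP⟩ := exists_pos_iff_of_unique_zero
      (f := fun x : ℝ => ((h k).symm (h i (x, 0))).2) (c := t i k)
      (hcg.comp (by fun_prop))
      (fun x => by rw [← hzero, hmem_iff i k hik])
      ⟨((h i).symm p).1, by simpa only [hpar i p hp] using hp0⟩
      ⟨((h i).symm q).1, by simpa only [hpar i q hq, Left.neg_pos_iff] using hq0⟩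
    exact ⟨P, fun _ => hP⟩
  choose P hP using hsign
  refine ⟨h, t, P, hh, hmem_iff, heq, hne, fun i j k hij hik hjk => ?_⟩
  rw [← hP i k hik _ (hne i j k hij hik hjk), ← hP j k hjk _ (hne j i k hij.symm hjk hik),
    heq i j hij]

/-! ### Directing and labeling the pseudolines. -/

/-- A finite strict total order is isomorphic to an initial segment of the natural numbers. -/
theorem exists_equiv_fin_of_isStrictTotalOrder {α : Type*} [Fintype α] (r : α → α → Prop)
    [IsStrictTotalOrder α r] {n : ℕ} (hn : Fintype.card α = n) :
    ∃ e : Fin n ≃ α, ∀ i j, i < j ↔ r (e i) (e j) := by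
  classical
  let _ := linearOrderOfSTO r
  exact ⟨(monoEquivOfFin α hn).toEquiv, fun i j => ((monoEquivOfFin α hn).lt_iff_lt).symm⟩

/-- Coherence survives flips. With `x`, `y` telling whether the directions of two pseudolines are
kept and `z` whether the sides of a third are kept, reversing a pseudoline negates both its crossing
sense and its comparison, and exchanging sides negates both crossing senses. -/
theorem iff_flip_congr {a b c d x y z : Prop} (h : (a ↔ b) ↔ (c ↔ d)) :
    (((a ↔ (x ↔ z)) ↔ (x ↔ b)) ↔ ((c ↔ (y ↔ z)) ↔ (y ↔ d))) := by
  by_cases x <;> by_cases y <;> by_cases z <;> simp_all <;> tauto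

/-- Parameters `u` of crossings and sides `Q` that are coherent at every crossing, when `z` is below
everything else: the relation `Q` is antisymmetric. -/
theorem coherent_antisymm {ι : Type*} {u : ι → ι → ℝ} {Q : ι → ι → Prop} {z : ι}
    (hne : ∀ i j k, i ≠ j → i ≠ k → j ≠ k → u i j ≠ u i k)
    (hQ : ∀ i j k, i ≠ j → i ≠ k → j ≠ k →
      ((Q i k ↔ u i k < u i j) ↔ (Q j k ↔ u j k < u j i)))
    (hzQ : ∀ j, j ≠ z → Q z j) (hQz : ∀ i, i ≠ z → ¬ Q i z) (i j : ι) (hij : i ≠ j) :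
    Q i j ↔ ¬ Q j i := by
  by_cases hi : i = z
  · subst hi
    exact iff_of_true (hzQ j hij.symm) (hQz j hij.symm)
  by_cases hj : j = z
  · subst hj
    exact iff_of_false (hQz i hij) (not_not.2 (hzQ i hij))
  -- The three coherence conditions of the triangle `i, j, z`, in which all senses of crossing that
  -- involve `z` are known, leave only opposite values for `Q i j` and `Q j i`.
  have b1 := hQ i j z hij hi hj
  have b2 := hQ i z j hi hij (Ne.symm hj)
  have b3 := hQ j z i hj hij.symm (Ne.symm hi)
  simp only [hzQ i hi, hzQ j hj, hQz i hi, hQz j hj, true_iff, false_iff] at b1 b2 b3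
  have c1 := hne i j z hij hi hj
  have c2 := hne j i z hij.symm hj hi
  have c3 := hne z i j (Ne.symm hi) (Ne.symm hj) hij
  grind

/-- A finite check on four pseudolines: a cycle `Q i j`, `Q j k`, `Q k i` contradicts the coherence
conditions of the triangles among `z, i, j, k`, whatever the order of the crossings on `z`. -/
theorem coherent_trans {ι : Type*} {u : ι → ι → ℝ} {Q : ι → ι → Prop} {z : ι}
    (hne : ∀ i j k, i ≠ j → i ≠ k → j ≠ k → u i j ≠ u i k)
    (hQ : ∀ i j k, i ≠ j → i ≠ k → j ≠ k →
      ((Q i k ↔ u i k < u i j) ↔ (Q j k ↔ u j k < u j i)))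
    (hzQ : ∀ j, j ≠ z → Q z j) (hQz : ∀ i, i ≠ z → ¬ Q i z) (i j k : ι)
    (hij : i ≠ j) (hjk : j ≠ k) (hik : i ≠ k) (h1 : Q i j) (h2 : Q j k) : Q i k := by
  by_contra h3
  have hi : i ≠ z := by rintro rfl; exact h3 (hzQ k hik.symm)
  have hj : j ≠ z := by rintro rfl; exact hQz i hij h1
  have hk : k ≠ z := by rintro rfl; exact hQz j hjk h2
  have hanti := coherent_antisymm hne hQ hzQ hQz
  have h4 := (hanti i j hij).1 h1
  have h5 := (hanti j k hjk).1 h2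
  have h6 := (hanti k i hik.symm).2 h3
  have c1 := hQ i j k hij hik hjk
  have c2 := hQ i k j hik hij hjk.symm
  have d1 := hQ i j z hij hi hj
  have d2 := hQ i k z hik hi hk
  have d3 := hQ j k z hjk hj hk
  have e1 := hQ i z j hi hij hj.symm
  have e2 := hQ j z k hj hjk hk.symm
  have e3 := hQ i z k hi hik hk.symm
  simp only [hzQ j hj, hzQ k hk, hQz i hi, hQz j hj, hQz k hk, h1, h2, h3, h5,
    true_iff, false_iff] at c1 c2 d1 d2 d3 e1 e2 e3
  have f1 := hne i j k hij hik hjk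
  have f2 := hne j i k hij.symm hjk hik
  have f3 := hne k i j hik.symm hjk.symm hij
  have g1 := hne i j z hij hi hj
  have g2 := hne i k z hik hi hk
  have g3 := hne j i z hij.symm hj hi
  have g4 := hne j k z hjk hj hk
  have g5 := hne k i z hik.symm hk hi
  have g6 := hne k j z hjk.symm hk hj
  have s1 := hne z i j hi.symm hj.symm hij
  have s2 := hne z j k hj.symm hk.symm hjk
  have s3 := hne z i k hi.symm hk.symm hik
  clear hQ hne hzQ hQz hanti
  by_cases x1 : u i j < u i k <;> by_cases x2 : u z i < u z j <;> by_cases x3 : u z j < u z k <;>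
    by_cases x4 : u z i < u z k <;> grind

/-- The crossing parameters of a simple arrangement become consistent on all triples of pseudolines
after directing and relabeling the pseudolines suitably. -/
theorem exists_consistent_labeling {ℓ : ℕ} {t : Fin ℓ → Fin ℓ → ℝ} {P : Fin ℓ → Fin ℓ → Prop}
    (hne : ∀ i j k, i ≠ j → i ≠ k → j ≠ k → t i j ≠ t i k)
    (hP : ∀ i j k, i ≠ j → i ≠ k → j ≠ k →
      ((P i k ↔ t i k < t i j) ↔ (P j k ↔ t j k < t j i))) :
    ∃ (u : Fin ℓ → Fin ℓ → ℝ) (e : Fin ℓ ≃ Fin ℓ),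
      (∀ i, u i = t i ∨ u i = -t i) ∧
      ∀ i j k, i < j → j < k →
        (u (e i) (e j) < u (e i) (e k) ↔ u (e j) (e i) < u (e j) (e k)) ∧
        (u (e i) (e j) < u (e i) (e k) ↔ u (e k) (e i) < u (e k) (e j)) := by
  classical
  rcases isEmpty_or_nonempty (Fin ℓ) with hemp | ⟨⟨z⟩⟩
  · exact ⟨t, Equiv.refl _, fun i => Or.inl rfl, fun i => hemp.elim i⟩
  -- `D i`: the direction of `i` is kept; `S j`: the sides of `j` are kept.
  let D : Fin ℓ → Prop := fun i => i = z ∨ ¬ P i z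
  let S : Fin ℓ → Prop := fun j => j = z ∨ P z j
  let u : Fin ℓ → Fin ℓ → ℝ := fun i j => if D i then t i j else -t i j
  let Q : Fin ℓ → Fin ℓ → Prop := fun i j => (P i j ↔ (D i ↔ S j))
  have hu : ∀ i, u i = t i ∨ u i = -t i := by
    intro i
    by_cases hD : D i
    · left; ext j; simp [u, hD]
    · right; ext j; simp [u, hD]
  have hune : ∀ i j k, i ≠ j → i ≠ k → j ≠ k → u i j ≠ u i k := by
    intro i j k hij hik hjk
    rcases hu i with h | h <;> simp [h, hne i j k hij hik hjk]
  have hult : ∀ i j k, i ≠ j → i ≠ k → j ≠ k → (u i j < u i k ↔ (D i ↔ t i j < t i k)) := by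
    intro i j k hij hik hjk
    by_cases hD : D i
    · simp [u, hD]
    · simpa [u, hD] using ⟨fun h => h.le, fun h => h.lt_of_ne (hne i j k hij hik hjk).symm⟩
  have hQ : ∀ i j k, i ≠ j → i ≠ k → j ≠ k →
      ((Q i k ↔ u i k < u i j) ↔ (Q j k ↔ u j k < u j i)) := by
    intro i j k hij hik hjk
    simp only [Q]
    rw [hult i k j hik hij hjk.symm, hult j k i hjk hij.symm hik.symm]
    exact iff_flip_congr (hP i j k hij hik hjk)
  -- `Q` is `P` corrected for both kinds of flips, and `D` and `S` are chosen so that now `z`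
  -- crosses every other pseudoline from the negative to the positive side, and every other one
  -- crosses `z` the opposite way.
  have hzQ : ∀ j, j ≠ z → Q z j := by
    intro j hj
    simp only [Q, D, S, hj, false_or, true_or, true_iff]
  have hQz : ∀ i, i ≠ z → ¬ Q i z := by
    intro i hi
    simp only [Q, D, S, hi, false_or, true_or, iff_true]
    tauto
  have hanti := coherent_antisymm hune hQ hzQ hQz
  have htrans := coherent_trans hune hQ hzQ hQz
  let r : Fin ℓ → Fin ℓ → Prop := fun i j => i ≠ j ∧ Q i j
  have : IsStrictTotalOrder (Fin ℓ) r :=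
    { trichotomous := by
        intro i j h1 h2
        by_contra hij
        have := hanti i j hij
        have := Ne.symm hij
        simp only [r] at h1 h2
        tauto
      irrefl := fun i h => h.1 rfl
      trans := by
        intro i j k h1 h2
        have hik : i ≠ k := by
          rintro rfl
          exact (hanti i j h1.1).1 h1.2 h2.2
        exact ⟨hik, htrans i j k h1.1 h2.1 hik h1.2 h2.2⟩ }
  obtain ⟨e, he⟩ := exists_equiv_fin_of_isStrictTotalOrder r (Fintype.card_fin ℓ)
  refine ⟨u, e, hu, fun i j k hij hjk => ?_⟩
  have r1 := (he i j).1 hij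
  have r2 := (he j k).1 hjk
  have r3 := (he i k).1 (hij.trans hjk)
  generalize e i = i at *
  generalize e j = j at *
  generalize e k = k at *
  obtain ⟨nij, qij⟩ := r1
  obtain ⟨njk, qjk⟩ := r2
  obtain ⟨nik, qik⟩ := r3
  have q1 := (hanti j k njk).1 qjk
  have q2 := hune i j k nij nik njk
  have q3 := hune j i k nij.symm njk nik
  have q4 := hune k i j nik.symm njk.symm nij
  have c1 := hQ i j k nij nik njk
  have c2 := hQ i k j nik nij njk.symm
  simp only [qij, qik, qjk, q1, true_iff, false_iff] at c1 c2
  clear hQ hune hP hne hult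
  grind

/-! ### A common linear order of all crossings. -/

/-- The orders of the crossings on the pseudolines have a common linear extension, in which the pair
`i < j` of pseudolines is placed at `K i j`. -/
theorem exists_linear_extension {ℓ : ℕ} {t : ℕ → ℕ → ℝ}
    (hne : ∀ i j k, i < ℓ → j < ℓ → k < ℓ → i ≠ j → i ≠ k → j ≠ k → t i j ≠ t i k)
    (ht : ∀ i j k, i < j → j < k → k < ℓ →
      (t i j < t i k ↔ t j i < t j k) ∧ (t i j < t i k ↔ t k i < t k j)) :
    ∃ K : ℕ → ℕ → ℝ,
      (∀ i j k l, i < j → j < ℓ → k < l → l < ℓ → K i j = K k l → i = k ∧ j = l) ∧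
      ∀ i j k, i < j → j < k → k < ℓ →
        (t i j < t i k ∧ K i j < K i k ∧ K i k < K j k) ∨
        (t i k < t i j ∧ K j k < K i k ∧ K i k < K i j) := by
  induction ℓ with
  | zero => exact ⟨0, by simp, by simp⟩
  | succ m ih =>
    obtain ⟨K, hinj, hK⟩ := ih
      (fun i j k hi hj hk => hne i j k (hi.trans m.lt_succ_self) (hj.trans m.lt_succ_self)
        (hk.trans m.lt_succ_self))
      (fun i j k hij hjk hk => ht i j k hij hjk (hk.trans m.lt_succ_self))
    obtain ⟨M, hM⟩ : ∃ M, ∀ i j, i < m → j < m → |K i j| < M := by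
      obtain ⟨M, hM⟩ := ((Finset.range m ×ˢ Finset.range m).image
        fun p => |K p.1 p.2|).bddAbove
      refine ⟨M + 1, fun i j hi hj => lt_of_le_of_lt (hM ?_) (lt_add_one M)⟩
      simp only [Finset.coe_image, mem_image, Finset.mem_coe, Finset.mem_product,
        Finset.mem_range]
      exact ⟨(i, j), ⟨hi, hj⟩, rfl⟩
    -- The new pseudoline `m` cuts the old crossings into those before it and those after it. They
    -- are shifted by `M + 2` to the left and to the right, which clears the window `(-2, 2)`; there
    -- `arctan` (with values within `π / 2 < 2`) places the crossings on `m` in their order.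
    let K' : ℕ → ℕ → ℝ := fun i j =>
      if j = m then Real.arctan (t m i)
      else if t i j < t i m then K i j - (M + 2) else K i j + (M + 2)
    have hlast : ∀ i, K' i m = Real.arctan (t m i) := fun i => by simp [K']
    have hA : ∀ i j, j < m → t i j < t i m → K' i j = K i j - (M + 2) := fun i j hj h => by
      simp [K', hj.ne, h]
    have hB : ∀ i j, j < m → ¬ t i j < t i m → K' i j = K i j + (M + 2) := fun i j hj h => by
      simp only [K', hj.ne, h, if_false]
    have hatan : ∀ x, -2 < Real.arctan x ∧ Real.arctan x < 2 := fun x =>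
      ⟨by linarith [Real.neg_pi_div_two_lt_arctan x, Real.pi_lt_four],
        by linarith [Real.arctan_lt_pi_div_two x, Real.pi_lt_four]⟩
    have hbd : ∀ i j, i < m → j < m → -M < K i j ∧ K i j < M := fun i j hi hj =>
      abs_lt.1 (hM i j hi hj)
    refine ⟨K', ?_, ?_⟩
    · intro i j k l hij hj hkl hl heq
      rcases Nat.lt_succ_iff_lt_or_eq.1 hj with hj | rfl <;>
        rcases Nat.lt_succ_iff_lt_or_eq.1 hl with hl | rfl
      · refine hinj i j k l hij hj hkl hl ?_
        have b1 := hbd i j (hij.trans hj) hj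
        have b2 := hbd k l (hkl.trans hl) hl
        by_cases h1 : t i j < t i m <;> by_cases h2 : t k l < t k m
        · rw [hA i j hj h1, hA k l hl h2] at heq; linarith
        · rw [hA i j hj h1, hB k l hl h2] at heq; linarith
        · rw [hB i j hj h1, hA k l hl h2] at heq; linarith
        · rw [hB i j hj h1, hB k l hl h2] at heq; linarith
      · exfalso
        have b1 := hbd i j (hij.trans hj) hj
        have b2 := hatan (t l k)
        rw [hlast] at heq
        by_cases h1 : t i j < t i l
        · rw [hA i j hj h1] at heq; linarith
        · rw [hB i j hj h1] at heq; linarith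
      · exfalso
        have b1 := hbd k l (hkl.trans hl) hl
        have b2 := hatan (t j i)
        rw [hlast] at heq
        by_cases h1 : t k l < t k j
        · rw [hA k l hl h1] at heq; linarith
        · rw [hB k l hl h1] at heq; linarith
      · rw [hlast, hlast] at heq
        have := Real.arctan_injective heq
        refine ⟨?_, rfl⟩
        by_contra hik
        exact hne l i k (by omega) (by omega) (by omega) (by omega) (by omega) hik this
    · intro i j k hij hjk hk
      have hijk := ht i j k hij hjk hk
      rcases Nat.lt_succ_iff_lt_or_eq.1 hk with hk | rfl
      · have b1 := hbd i j (by omega) (by omega)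
        have b2 := hbd i k (by omega) (by omega)
        have b3 := hbd j k (by omega) (by omega)
        have n1 := hne i j m (by omega) (by omega) (by omega) (by omega) (by omega) (by omega)
        have n2 := hne i k m (by omega) (by omega) (by omega) (by omega) (by omega) (by omega)
        have n3 := hne j k m (by omega) (by omega) (by omega) (by omega) (by omega) (by omega)
        have n4 := hne k i j (by omega) (by omega) (by omega) (by omega) (by omega) (by omega)
        have n5 := hne k i m (by omega) (by omega) (by omega) (by omega) (by omega) (by omega)
        have m2 := ht i k m (by omega) (by omega) (by omega)
        have m3 := ht j k m (by omega) (by omega) (by omega)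
        have a1 := hA i j (by omega)
        have a2 := hA i k (by omega)
        have a3 := hA j k (by omega)
        have e1 := hB i j (by omega)
        have e2 := hB i k (by omega)
        have e3 := hB j k (by omega)
        rcases hK i j k hij hjk hk with ⟨h0, h1, h2⟩ | ⟨h0, h1, h2⟩
        · left
          have h3 := hijk.2.1 h0
          -- By consistency with `m`, the crossings of the triangle that lie before `m` form an
          -- initial segment of its order `ij, ik, jk`. So the shifts cannot reverse this order; the
          -- other case is symmetric.
          have g1 : t i k < t i m → t i j < t i m := fun h => h0.trans h
          have g2 : t j k < t j m → t i k < t i m := fun h => m2.1.2 (h3.trans (m3.1.1 h))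
          refine ⟨h0, ?_⟩
          by_cases c3 : t j k < t j m
          · rw [a1 (g1 (g2 c3)), a2 (g2 c3), a3 c3]; constructor <;> linarith
          rw [e3 c3]
          by_cases c2 : t i k < t i m
          · rw [a1 (g1 c2), a2 c2]; constructor <;> linarith
          rw [e2 c2]
          by_cases c1 : t i j < t i m
          · rw [a1 c1]; constructor <;> linarith
          · rw [e1 c1]; constructor <;> linarith
        · right
          have h3 : t k j < t k i := lt_of_le_of_ne (not_lt.1 fun h => h0.not_gt (hijk.2.2 h)) n4.symm
          have g1 : t i j < t i m → t i k < t i m := fun h => h0.trans h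
          have g2 : t i k < t i m → t j k < t j m := fun h => m3.1.2 (h3.trans (m2.1.1 h))
          refine ⟨h0, ?_⟩
          by_cases c1 : t i j < t i m
          · rw [a1 c1, a2 (g1 c1), a3 (g2 (g1 c1))]; constructor <;> linarith
          rw [e1 c1]
          by_cases c2 : t i k < t i m
          · rw [a2 c2, a3 (g2 c2)]; constructor <;> linarith
          rw [e2 c2]
          by_cases c3 : t j k < t j m
          · rw [a3 c3]; constructor <;> linarith
          · rw [e3 c3]; constructor <;> linarith
      · have b1 := hbd i j (by omega) (by omega)
        have b2 := hatan (t k i)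
        have b3 := hatan (t k j)
        have n1 := hne i j k (by omega) (by omega) (by omega) (by omega) (by omega) (by omega)
        have n4 := hne k i j (by omega) (by omega) (by omega) (by omega) (by omega) (by omega)
        rw [hlast, hlast]
        by_cases h : t i j < t i k
        · left
          rw [hA i j hjk h]
          exact ⟨h, by linarith, Real.arctan_strictMono (hijk.2.1 h)⟩
        · right
          rw [hB i j hjk h]
          exact ⟨lt_of_le_of_ne (not_lt.1 h) n1.symm, Real.arctan_strictMono
            (lt_of_le_of_ne (not_lt.1 fun h' => h (hijk.2.2 h')) n4.symm), by linarith⟩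

/-! ### Straight-line drawings with one row per level. -/

/-- The event `x` is drawn in the row of its level, to the right of all earlier events of its level. -/
def levelPoint (lev row : ℕ → ℕ) (x : ℕ) : ℕ × ℕ :=
  (1 + ((Finset.range x).filter fun r => lev r = lev x).card, row (lev x))

theorem levelPoint_fst_lt {lev : ℕ → ℕ} (row : ℕ → ℕ) {x y : ℕ} (hxy : x < y)
    (hlev : lev x = lev y) : (levelPoint lev row x).1 < (levelPoint lev row y).1 := by
  refine Nat.add_lt_add_left (Finset.card_lt_card ?_) 1
  rw [Finset.ssubset_iff_of_subset]
  · exact ⟨x, by simp [hxy, hlev], by simp⟩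
  · intro r hr
    simp only [Finset.mem_filter, Finset.mem_range] at hr ⊢
    exact ⟨hr.1.trans hxy, hr.2.trans hlev⟩

theorem levelPoint_fst_lt_iff {lev : ℕ → ℕ} (row : ℕ → ℕ) {x y : ℕ} (hlev : lev x = lev y) :
    (levelPoint lev row x).1 < (levelPoint lev row y).1 ↔ x < y := by
  refine ⟨fun h => ?_, fun h => levelPoint_fst_lt row h hlev⟩
  by_contra! hyx
  rcases hyx.eq_or_lt with rfl | hyx
  · exact h.false
  · exact h.asymm (levelPoint_fst_lt row hyx hlev.symm)

/-- Two events are joined along a track `τ`, on which nothing happens between them. -/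
def IsTrackEdge (lev : ℕ → ℕ) (x y τ : ℕ) : Prop :=
  x ≠ y ∧ (lev x = τ ∨ lev x + 1 = τ) ∧ (lev y = τ ∨ lev y + 1 = τ) ∧
    ∀ u, min x y < u → u < max x y → lev u ≠ τ ∧ lev u + 1 ≠ τ

theorem IsTrackEdge.symm {lev : ℕ → ℕ} {x y τ : ℕ} (h : IsTrackEdge lev x y τ) :
    IsTrackEdge lev y x τ := by
  obtain ⟨h1, h2, h3, h4⟩ := h
  exact ⟨h1.symm, h3, h2, by rwa [min_comm, max_comm]⟩

section
variable {lev row : ℕ → ℕ}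

/-- The ends of an edge are in equal or adjacent levels. In one row, position follows time, so a
further vertex on the segment would be an event on the track between the two ends. For adjacent
levels no used row lies in between, and the segment meets either end row only at its endpoint. -/
theorem IsTrackEdge.eq_of_mem_segment (hrow : StrictMono row) {x y τ w : ℕ}
    (h : IsTrackEdge lev x y τ)
    (hw : gridPoint (levelPoint lev row w) ∈
      segment ℝ (gridPoint (levelPoint lev row x)) (gridPoint (levelPoint lev row y))) :
    w = x ∨ w = y := by
  wlog hle : lev x ≤ lev y generalizing x y
  · rw [segment_symm] at hw
    exact (this h.symm hw (by omega)).symm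
  rcases hle.eq_or_lt with heq | hlt
  · wlog hxy : x < y generalizing x y
    · rw [segment_symm] at hw
      have hne := h.1
      exact (this h.symm hw heq.ge heq.symm (by omega)).symm
    obtain ⟨-, hx, hy, hbetween⟩ := h
    obtain ⟨a, b, ha, hb, hab, heqw⟩ := hw
    simp only [gridPoint, Prod.smul_mk, Prod.mk_add_mk, smul_eq_mul, Prod.mk.injEq] at heqw
    obtain ⟨h1, h2⟩ := heqw
    have hlevw : lev w = lev x := by
      apply hrow.injective
      simp only [levelPoint, ← heq] at h2
      rw [← add_mul, hab, one_mul] at h2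
      exact_mod_cast h2.symm
    have hX : ((levelPoint lev row x).1 : ℝ) < (levelPoint lev row y).1 := by
      exact_mod_cast levelPoint_fst_lt row hxy heq
    have hxw : ¬ w < x := by
      rw [← levelPoint_fst_lt_iff row hlevw, not_lt, ← @Nat.cast_le ℝ, ← h1]
      have := mul_le_mul_of_nonneg_left hX.le hb
      calc _ = a * ((levelPoint lev row x).1 : ℝ) + b * (levelPoint lev row x).1 := by
            rw [← add_mul, hab, one_mul]
        _ ≤ _ := by linarith
    have hwy : ¬ y < w := by
      rw [← levelPoint_fst_lt_iff row (hlevw.trans heq).symm, not_lt, ← @Nat.cast_le ℝ, ← h1]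
      have := mul_le_mul_of_nonneg_left hX.le ha
      calc _ ≤ a * ((levelPoint lev row y).1 : ℝ) + b * (levelPoint lev row y).1 := by linarith
        _ = _ := by rw [← add_mul, hab, one_mul]
    by_contra! hne
    have := hbetween w (by omega) (by omega)
    omega
  · obtain ⟨-, hx, hy, -⟩ := h
    obtain ⟨a, b, ha, hb, hab, heqw⟩ := hw
    simp only [gridPoint, Prod.smul_mk, Prod.mk_add_mk, smul_eq_mul, Prod.mk.injEq] at heqw
    obtain ⟨h1, h2⟩ := heqw
    have hR : ((levelPoint lev row x).2 : ℝ) < (levelPoint lev row y).2 := by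
      exact_mod_cast hrow hlt
    have hx2 : lev x ≤ lev w := by
      rw [← hrow.le_iff_le, ← @Nat.cast_le ℝ]
      change ((levelPoint lev row x).2 : ℝ) ≤ (levelPoint lev row w).2
      rw [← h2]
      have := mul_le_mul_of_nonneg_left hR.le hb
      calc _ = a * ((levelPoint lev row x).2 : ℝ) + b * (levelPoint lev row x).2 := by
            rw [← add_mul, hab, one_mul]
        _ ≤ _ := by linarith
    have hy2 : lev w ≤ lev y := by
      rw [← hrow.le_iff_le, ← @Nat.cast_le ℝ]
      change ((levelPoint lev row w).2 : ℝ) ≤ (levelPoint lev row y).2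
      rw [← h2]
      have := mul_le_mul_of_nonneg_left hR.le ha
      calc _ ≤ a * ((levelPoint lev row y).2 : ℝ) + b * (levelPoint lev row y).2 := by linarith
        _ = _ := by rw [← add_mul, hab, one_mul]
    have hunique : ∀ z, lev w = lev z →
        ((levelPoint lev row w).1 : ℝ) = (levelPoint lev row z).1 → w = z := by
      intro z hz h
      have h := Nat.cast_injective h
      have g1 := levelPoint_fst_lt_iff row hz
      have g2 := levelPoint_fst_lt_iff row hz.symm
      omega
    rcases (show lev w = lev x ∨ lev w = lev y by omega) with hlw | hlw
    · left
      have h3 : (levelPoint lev row w).2 = (levelPoint lev row x).2 := by simp [levelPoint, hlw]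
      rw [h3] at h2
      have hb0 : b = 0 := by
        have : b * (((levelPoint lev row y).2 : ℝ) - (levelPoint lev row x).2) = 0 := by
          have : a = 1 - b := by linarith
          rw [this] at h2
          linarith
        rcases mul_eq_zero.1 this with h | h
        · exact h
        · linarith
      have ha1 : a = 1 := by linarith
      refine hunique x hlw ?_
      rw [← h1, hb0, ha1]
      ring
    · right
      have h3 : (levelPoint lev row w).2 = (levelPoint lev row y).2 := by simp [levelPoint, hlw]
      rw [h3] at h2
      have ha0 : a = 0 := by
        have : a * (((levelPoint lev row y).2 : ℝ) - (levelPoint lev row x).2) = 0 := by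
          have : b = 1 - a := by linarith
          rw [this] at h2
          linarith
        rcases mul_eq_zero.1 this with h | h
        · exact h
        · linarith
      have hb1 : b = 1 := by linarith
      refine hunique y hlw ?_
      rw [← h1, ha0, hb1]
      ring

theorem lt_convex_comb_lt {a b : ℝ} (ha : 0 < a) (hb : 0 < b) (hab : a + b = 1)
    {u v : ℝ} (huv : u < v) : u < a * u + b * v ∧ a * u + b * v < v := by
  have e1 := mul_lt_mul_of_pos_left huv ha
  have e2 := mul_lt_mul_of_pos_left huv hb
  have e3 : a * u + b * u = u := by rw [← add_mul, hab, one_mul]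
  have e4 : a * v + b * v = v := by rw [← add_mul, hab, one_mul]
  constructor <;> linarith

/-- Overlapping segments in a row have overlapping time intervals. Neither interval has an event of
this level in its interior, since such an event would touch the track of the edge, so the intervals
coincide. -/
theorem IsTrackEdge.disjoint_openSegment_of_level_eq {x y τ x' y' τ' : ℕ}
    (h : IsTrackEdge lev x y τ) (h' : IsTrackEdge lev x' y' τ') (hne : s(x, y) ≠ s(x', y'))
    (heq : lev x = lev y) (heq' : lev x' = lev y') (hlev : lev x = lev x') :
    Disjoint (openSegment ℝ (gridPoint (levelPoint lev row x)) (gridPoint (levelPoint lev row y)))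
      (openSegment ℝ (gridPoint (levelPoint lev row x'))
        (gridPoint (levelPoint lev row y'))) := by
  wlog hxy : x < y generalizing x y
  · have hxy' := h.1
    rw [openSegment_symm]
    exact this h.symm (by rwa [Sym2.eq_swap]) heq.symm (heq.symm.trans hlev) (by omega)
  wlog hxy' : x' < y' generalizing x' y'
  · have hxy' := h'.1
    rw [openSegment_symm ℝ (gridPoint (levelPoint lev row x'))]
    exact this h'.symm heq'.symm (by rwa [Sym2.eq_swap (a := y')]) (hlev.trans heq') (by omega)
  rw [Set.disjoint_left]
  rintro p ⟨a, b, ha, hb, hab, rfl⟩ ⟨a', b', ha', hb', hab', hp⟩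
  simp only [gridPoint, Prod.smul_mk, Prod.mk_add_mk, smul_eq_mul, Prod.mk.injEq] at hp
  have c1 := lt_convex_comb_lt ha hb hab
    (Nat.cast_lt (α := ℝ).2 (levelPoint_fst_lt row hxy heq))
  have c2 := lt_convex_comb_lt ha' hb' hab'
    (Nat.cast_lt (α := ℝ).2 (levelPoint_fst_lt row hxy' heq'))
  rw [hp.1] at c2
  have o1 := (levelPoint_fst_lt_iff row (hlev.trans heq')).1
    (Nat.cast_lt.1 (c1.1.trans c2.2))
  have o2 := (levelPoint_fst_lt_iff row (hlev.symm.trans heq)).1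
    (Nat.cast_lt.1 (c2.1.trans c1.2))
  obtain ⟨-, g1, -, g2⟩ := h
  obtain ⟨-, g1', -, g2'⟩ := h'
  rw [min_eq_left hxy.le, max_eq_right hxy.le] at g2
  rw [min_eq_left hxy'.le, max_eq_right hxy'.le] at g2'
  have b1 := g2 x'
  have b2 := g2 y'
  have b3 := g2' x
  have b4 := g2' y
  apply hne
  rw [show x = x' by omega, show y = y' by omega]

/-- Both edges run along the only track shared by the two levels. With no event on the track between
the ends of an edge, one edge is weakly earlier at both ends (`key`) and strictly earlier at one.
Points at equal height have equal convex weights, so the earlier edge is strictly to the left. -/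
theorem IsTrackEdge.disjoint_openSegment_of_level_lt (hrow : StrictMono row) {x y τ x' y' τ' : ℕ}
    (h : IsTrackEdge lev x y τ) (h' : IsTrackEdge lev x' y' τ') (hne : s(x, y) ≠ s(x', y'))
    (hlt : lev x < lev y) (heq : lev x = lev x') (heq' : lev y = lev y') :
    Disjoint (openSegment ℝ (gridPoint (levelPoint lev row x)) (gridPoint (levelPoint lev row y)))
      (openSegment ℝ (gridPoint (levelPoint lev row x'))
        (gridPoint (levelPoint lev row y'))) := by
  have key : (x ≤ x' ∧ y ≤ y') ∨ (x' ≤ x ∧ y' ≤ y) := by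
    obtain ⟨n1, g1, g3, g2⟩ := h
    obtain ⟨n2, g1', g3', g2'⟩ := h'
    have b1 := g2 x'
    have b2 := g2 y'
    have b3 := g2' x
    have b4 := g2' y
    have n3 : x ≠ y' := by rintro rfl; omega
    have n4 : x' ≠ y := by rintro rfl; omega
    omega
  wlog hle : x ≤ x' ∧ y ≤ y' generalizing x y x' y' τ τ'
  · exact (this h' h hne.symm (by omega) heq.symm heq'.symm key.symm
      (key.resolve_left hle)).symm
  rw [Set.disjoint_left]
  rintro p ⟨a, b, ha, hb, hab, rfl⟩ ⟨a', b', ha', hb', hab', hp⟩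
  simp only [gridPoint, Prod.smul_mk, Prod.mk_add_mk, smul_eq_mul, Prod.mk.injEq] at hp
  obtain ⟨h1, h2⟩ := hp
  change a' * (row (lev x') : ℝ) + b' * (row (lev y') : ℝ) =
    a * (row (lev x) : ℝ) + b * (row (lev y) : ℝ) at h2
  rw [← heq, ← heq'] at h2
  have hR : (row (lev x) : ℝ) < row (lev y) := by exact_mod_cast hrow hlt
  have hbb : b' = b := by
    have : (b' - b) * ((row (lev y) : ℝ) - row (lev x)) = 0 := by
      rw [show a' = 1 - b' by linarith, show a = 1 - b by linarith] at h2
      linarith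
    rcases mul_eq_zero.1 this with h | h <;> linarith
  have haa : a' = a := by linarith
  subst hbb haa
  have mono : ∀ u v, u ≤ v → lev u = lev v →
      ((levelPoint lev row u).1 : ℝ) ≤ (levelPoint lev row v).1 := by
    intro u v huv hl
    rcases huv.eq_or_lt with rfl | huv
    · rfl
    · exact Nat.cast_le.2 (levelPoint_fst_lt row huv hl).le
  have m1 := mul_le_mul_of_nonneg_left (mono x x' hle.1 heq) ha.le
  have m2 := mul_le_mul_of_nonneg_left (mono y y' hle.2 heq') hb.le
  rcases hle.1.eq_or_lt with hx | hx
  · rcases hle.2.eq_or_lt with hy | hy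
    · exact hne (by rw [hx, hy])
    · have := mul_lt_mul_of_pos_left (Nat.cast_lt (α := ℝ).2 (levelPoint_fst_lt row hy heq')) hb
      linarith
  · have := mul_lt_mul_of_pos_left (Nat.cast_lt (α := ℝ).2 (levelPoint_fst_lt row hx heq)) ha
    linarith

/-- Unless both edges have the same pair of levels, heights alone separate them: an open edge
occupies either one row or the open strip between the rows of two adjacent levels. -/
theorem IsTrackEdge.disjoint_openSegment (hrow : StrictMono row) {x y τ x' y' τ' : ℕ}
    (h : IsTrackEdge lev x y τ) (h' : IsTrackEdge lev x' y' τ') (hne : s(x, y) ≠ s(x', y')) :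
    Disjoint (openSegment ℝ (gridPoint (levelPoint lev row x)) (gridPoint (levelPoint lev row y)))
      (openSegment ℝ (gridPoint (levelPoint lev row x'))
        (gridPoint (levelPoint lev row y'))) := by
  wlog hle : lev x ≤ lev y generalizing x y
  · rw [openSegment_symm]
    exact this h.symm (by rwa [Sym2.eq_swap]) (by omega)
  wlog hle' : lev x' ≤ lev y' generalizing x' y'
  · rw [openSegment_symm ℝ (gridPoint (levelPoint lev row x'))]
    exact this h'.symm (by rwa [Sym2.eq_swap (a := y')]) (by omega)
  have h2 := h.2
  have h2' := h'.2
  by_cases hsame : lev x = lev x' ∧ lev y = lev y'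
  · rcases hle.eq_or_lt with heq | hlt
    · exact h.disjoint_openSegment_of_level_eq h' hne heq (by omega) hsame.1
    · exact h.disjoint_openSegment_of_level_lt hrow h' hne hlt hsame.1 hsame.2
  rw [Set.disjoint_left]
  rintro p ⟨a, b, ha, hb, hab, rfl⟩ ⟨a', b', ha', hb', hab', hp⟩
  simp only [gridPoint, Prod.smul_mk, Prod.mk_add_mk, smul_eq_mul, Prod.mk.injEq] at hp
  have hrows := hp.2
  change a' * (row (lev x') : ℝ) + b' * (row (lev y') : ℝ) =
    a * (row (lev x) : ℝ) + b * (row (lev y) : ℝ) at hrows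
  have hR : lev x < lev y → _ := fun h =>
    lt_convex_comb_lt ha hb hab (Nat.cast_lt (α := ℝ).2 (hrow h))
  have hR' : lev x' < lev y' → _ := fun h =>
    lt_convex_comb_lt ha' hb' hab' (Nat.cast_lt (α := ℝ).2 (hrow h))
  rcases hle.eq_or_lt with heq | hlt <;> rcases hle'.eq_or_lt with heq' | hlt'
  · rw [← heq, ← heq', ← add_mul, ← add_mul, hab, hab', one_mul, one_mul] at hrows
    have := hrow.injective (Nat.cast_injective hrows)
    omega
  · rw [← heq, ← add_mul, hab, one_mul] at hrows
    have := hR' hlt'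
    rw [hrows] at this
    have g1 := hrow.lt_iff_lt.1 (Nat.cast_lt.1 this.1)
    have g2 := hrow.lt_iff_lt.1 (Nat.cast_lt.1 this.2)
    omega
  · rw [← heq', ← add_mul, hab', one_mul] at hrows
    have := hR hlt
    rw [← hrows] at this
    have g1 := hrow.lt_iff_lt.1 (Nat.cast_lt.1 this.1)
    have g2 := hrow.lt_iff_lt.1 (Nat.cast_lt.1 this.2)
    omega
  · have e1 := hR hlt
    have e2 := hR' hlt'
    rw [hrows] at e2
    have g1 := hrow.lt_iff_lt.1 (Nat.cast_lt.1 (e1.1.trans e2.2))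
    have g2 := hrow.lt_iff_lt.1 (Nat.cast_lt.1 (e2.1.trans e1.2))
    omega

/-- A graph whose edges run along tracks has a planar drawing with its levels placed in rows. -/
theorem isPlanarStraightLineDrawing_levelPoint (hrow : StrictMono row) {V : Type*}
    {G : SimpleGraph V} {s : V → ℕ} (hs : Function.Injective s)
    (hG : ∀ u v, G.Adj u v → ∃ τ, IsTrackEdge lev (s u) (s v) τ) :
    IsPlanarStraightLineDrawing G fun v => gridPoint (levelPoint lev row (s v)) where
  injective := by
    intro u v huv
    simp only [gridPoint, Prod.mk.injEq, Nat.cast_inj] at huv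
    have hlev : lev (s u) = lev (s v) := hrow.injective huv.2
    have g1 := levelPoint_fst_lt_iff row hlev
    have g2 := levelPoint_fst_lt_iff row hlev.symm
    apply hs
    omega
  vertex_edge := by
    intro u v w huv hw
    obtain ⟨τ, hτ⟩ := hG u v huv
    exact (hτ.eq_of_mem_segment hrow hw).imp (fun h => hs h) (fun h => hs h)
  edge_edge := by
    intro u v x y huv hxy hne
    obtain ⟨τ, hτ⟩ := hG u v huv
    obtain ⟨τ', hτ'⟩ := hG x y hxy
    refine hτ.disjoint_openSegment hrow hτ' fun h => hne ?_
    exact Sym2.map.injective hs (by simpa using h)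

end

/-! ### Sweeps, positions on tracks, and wiring diagrams. -/

/-- `T i j` is the time of the crossing of the pseudolines `i` and `j` in a left-to-right sweep of an
arrangement with `N` crossings. -/
structure IsSweep {ℓ : ℕ} (T : Fin ℓ → Fin ℓ → ℕ) (N : ℕ) : Prop where
  symm : ∀ i j, T i j = T j i
  injective : ∀ i j k l, i < j → k < l → T i j = T k l → i = k ∧ j = l
  lt : ∀ i j, i ≠ j → T i j < N
  exists_eq : ∀ x < N, ∃ i j, i < j ∧ T i j = x
  consistent : ∀ i j k, i < j → j < k →
    (T i j < T i k ∧ T i k < T j k) ∨ (T j k < T i k ∧ T i k < T i j)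

theorem card_lt_pairs (ℓ : ℕ) :
    Fintype.card {p : Fin ℓ × Fin ℓ // p.1 < p.2} = ℓ * (ℓ - 1) / 2 := by
  have e : {p : Fin ℓ × Fin ℓ // p.1 < p.2} ≃ Σ j : Fin ℓ, Fin j :=
    { toFun := fun p => ⟨p.1.2, ⟨p.1.1, p.2⟩⟩
      invFun := fun q => ⟨(⟨q.2, q.2.2.trans q.1.2⟩, q.1), q.2.2⟩
      left_inv := fun _ => rfl
      right_inv := fun _ => rfl }
  rw [Fintype.card_congr e, Fintype.card_sigma]
  simp only [Fintype.card_fin]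
  rw [Fin.sum_univ_eq_sum_range (fun i => i) ℓ, Finset.sum_range_id]

/-- Consistent crossing parameters come from a sweep. -/
theorem exists_isSweep {ℓ : ℕ} {t : Fin ℓ → Fin ℓ → ℝ}
    (hne : ∀ i j k, i ≠ j → i ≠ k → j ≠ k → t i j ≠ t i k)
    (ht : ∀ i j k, i < j → j < k →
      (t i j < t i k ↔ t j i < t j k) ∧ (t i j < t i k ↔ t k i < t k j)) :
    ∃ T : Fin ℓ → Fin ℓ → ℕ, IsSweep T (ℓ * (ℓ - 1) / 2) ∧
      ∀ i j k, i ≠ j → i ≠ k → j ≠ k → (T i j < T i k ↔ t i j < t i k) := by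
  obtain ⟨K, hinj, hK⟩ := exists_linear_extension (ℓ := ℓ)
    -- Extension by `0` to natural indices, the form in which the induction can split off the last
    -- pseudoline.
    (t := fun i j => if h : i < ℓ ∧ j < ℓ then t ⟨i, h.1⟩ ⟨j, h.2⟩ else 0)
    (by
      intro i j k hi hj hk hij hik hjk
      simp only [hi, hj, hk, and_self, dite_true]
      exact hne _ _ _ (by simpa using hij) (by simpa using hik) (by simpa using hjk))
    (by
      intro i j k hij hjk hk
      have hj := hjk.trans hk
      have hi := hij.trans hj
      simp only [hi, hj, hk, and_self, dite_true]
      exact ht _ _ _ hij hjk)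
  let r : {p : Fin ℓ × Fin ℓ // p.1 < p.2} → {p : Fin ℓ × Fin ℓ // p.1 < p.2} → Prop :=
    fun p q => K p.1.1 p.1.2 < K q.1.1 q.1.2
  have : IsStrictTotalOrder _ r :=
    { trichotomous := by
        rintro ⟨⟨a, b⟩, hab⟩ ⟨⟨c, d⟩, hcd⟩ h1 h2
        obtain ⟨h3, h4⟩ := hinj a b c d hab b.2 hcd d.2
          (le_antisymm (not_lt.1 h2) (not_lt.1 h1))
        simp [Fin.ext h3, Fin.ext h4]
      irrefl := fun p => lt_irrefl _
      trans := fun p q s => lt_trans }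
  obtain ⟨e, he⟩ := exists_equiv_fin_of_isStrictTotalOrder r (card_lt_pairs ℓ)
  let T : Fin ℓ → Fin ℓ → ℕ := fun i j =>
    if h : i < j then e.symm ⟨(i, j), h⟩ else if h : j < i then e.symm ⟨(j, i), h⟩ else 0
  have hT : ∀ i j (h : i < j), T i j = e.symm ⟨(i, j), h⟩ := fun i j h => by simp [T, h]
  have hsymm : ∀ i j, T i j = T j i := by
    intro i j
    rcases lt_trichotomy i j with h | rfl | h
    · simp [T, h, h.not_gt]
    · rfl
    · simp [T, h, h.not_gt]
  have hTK : ∀ i j k l, i < j → k < l → (T i j < T k l ↔ K i j < K k l) := by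
    intro i j k l hij hkl
    rw [hT i j hij, hT k l hkl, Fin.val_fin_lt, he]
    simp [r]
  have hcons : ∀ i j k, i < j → j < k →
      (t i j < t i k ∧ T i j < T i k ∧ T i k < T j k) ∨
      (t i k < t i j ∧ T j k < T i k ∧ T i k < T i j) := by
    intro i j k hij hjk
    have := hK i j k hij hjk k.2
    simp only [Fin.is_lt, and_self, dite_true, Fin.eta] at this
    rwa [hTK _ _ _ _ hij (hij.trans hjk), hTK _ _ _ _ (hij.trans hjk) hjk,
      hTK _ _ _ _ hjk (hij.trans hjk), hTK _ _ _ _ (hij.trans hjk) hij]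
  refine ⟨T, ⟨hsymm, ?_, ?_, ?_, fun i j k hij hjk => (hcons i j k hij hjk).imp And.right And.right⟩,
    ?_⟩
  · intro i j k l hij hkl h
    rw [hT i j hij, hT k l hkl] at h
    simpa using e.symm.injective (Fin.ext h)
  · intro i j hij
    rcases lt_or_gt_of_ne hij with h | h
    · rw [hT i j h]; exact Fin.is_lt _
    · rw [hsymm, hT j i h]; exact Fin.is_lt _
  · intro x hx
    refine ⟨(e ⟨x, hx⟩).1.1, (e ⟨x, hx⟩).1.2, (e ⟨x, hx⟩).2, ?_⟩
    rw [hT _ _ (e ⟨x, hx⟩).2]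
    simp
  -- All six comparisons for a sorted triple; the six possible orders of an arbitrary triple then
  -- each pick one of them.
  · have key : ∀ i j k, i < j → j < k → (T i j < T i k ↔ t i j < t i k) ∧
        (T i k < T i j ↔ t i k < t i j) ∧ (T j i < T j k ↔ t j i < t j k) ∧
        (T j k < T j i ↔ t j k < t j i) ∧ (T k i < T k j ↔ t k i < t k j) ∧
        (T k j < T k i ↔ t k j < t k i) := by
      intro i j k hij hjk
      have h1 := ht i j k hij hjk
      have n1 := hne j i k hij.ne' hjk.ne (hij.trans hjk).ne
      have n2 := hne k i j (hij.trans hjk).ne' hjk.ne' hij.ne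
      rw [hsymm j i, hsymm k i, hsymm k j]
      rcases hcons i j k hij hjk with ⟨a, b, c⟩ | ⟨a, b, c⟩
      · have a1 := h1.1.1 a
        have a2 := h1.2.1 a
        simp [a, a1, a2, b, c, b.trans c, a.not_gt, a1.not_gt, a2.not_gt, b.not_gt, c.not_gt,
          (b.trans c).not_gt]
      · have a1 : t j k < t j i := lt_of_le_of_ne (not_lt.1 fun h => a.not_gt (h1.1.2 h)) n1.symm
        have a2 : t k j < t k i := lt_of_le_of_ne (not_lt.1 fun h => a.not_gt (h1.2.2 h)) n2.symm
        simp [a, a1, a2, b, c, b.trans c, a.not_gt, a1.not_gt, a2.not_gt, b.not_gt, c.not_gt,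
          (b.trans c).not_gt]
    intro i j k hij hik hjk
    rcases lt_or_gt_of_ne hij with h1 | h1 <;> rcases lt_or_gt_of_ne hik with h2 | h2 <;>
      rcases lt_or_gt_of_ne hjk with h3 | h3
    · exact (key i j k h1 h3).1
    · exact (key i k j h2 h3).2.1
    · exact absurd (h1.trans h3) h2.not_gt
    · exact (key k i j h2 h1).2.2.2.1
    · exact (key j i k h1 h2).2.2.1
    · exact absurd (h2.trans h3) h1.not_gt
    · exact (key j k i h3 h2).2.2.2.2.1
    · exact (key k j i h3 h1).2.2.2.2.2

open Classical in
/-- The number of pseudolines below `i` just before time `x`. -/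
noncomputable def sweepPos {ℓ : ℕ} (T : Fin ℓ → Fin ℓ → ℕ) (x : ℕ) (i : Fin ℓ) : ℕ :=
  (Finset.univ.filter fun k => k ≠ i ∧ (k < i ↔ x ≤ T k i)).card

open Classical in
/-- The level of the crossing at time `x`. -/
noncomputable def sweepLevel {ℓ : ℕ} (T : Fin ℓ → Fin ℓ → ℕ) (x : ℕ) : ℕ :=
  if h : ∃ i j, i < j ∧ T i j = x then sweepPos T x h.choose else 0

namespace IsSweep

variable {ℓ N : ℕ} {T : Fin ℓ → Fin ℓ → ℕ}

/-- The relation of lying below just before time `x` is transitive. -/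
theorem below_trans (hT : IsSweep T N) {x : ℕ} {k i j : Fin ℓ} (hki : k ≠ i)
    (hk : k < i ↔ x ≤ T k i) (hij : i ≠ j) (hi : i < j ↔ x ≤ T i j) :
    k ≠ j ∧ (k < j ↔ x ≤ T k j) := by
  have hkj : k ≠ j := by
    rintro rfl
    rw [hT.symm] at hk
    rcases lt_or_gt_of_ne hki with h | h
    · exact h.not_gt (hi.2 (hk.1 h))
    · exact h.not_gt (hk.2 (hi.1 h))
  refine ⟨hkj, ?_⟩
  rcases lt_or_gt_of_ne hki with h1 | h1 <;> rcases lt_or_gt_of_ne hij with h2 | h2 <;>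
    rcases lt_or_gt_of_ne hkj with h3 | h3
  · have := hT.consistent k i j h1 h2
    simp only [h1, h2, h3, true_iff] at *
    omega
  · exact absurd (h1.trans h2) h3.not_gt
  · have := hT.consistent k j i h3 h2
    rw [hT.symm i j] at *
    simp only [h1, h2.not_gt, h3, true_iff, false_iff] at *
    omega
  · have := hT.consistent j k i h3 h1
    rw [hT.symm i j, hT.symm k j] at *
    simp only [h1, h2.not_gt, h3.not_gt, true_iff, false_iff] at *
    omega
  · have := hT.consistent i k j h1 h3
    rw [hT.symm k i] at *
    simp only [h1.not_gt, h2, h3, true_iff, false_iff] at *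
    omega
  · have := hT.consistent i j k h2 h3
    rw [hT.symm k i, hT.symm k j] at *
    simp only [h1.not_gt, h2, h3.not_gt, true_iff, false_iff] at *
    omega
  · exact absurd (h2.trans h1) h3.not_gt
  · have := hT.consistent j i k h2 h1
    rw [hT.symm k i, hT.symm k j, hT.symm i j] at *
    simp only [h1.not_gt, h2.not_gt, h3.not_gt, false_iff] at *
    omega

/-- The hypothesis says that `i` is below `j` just before time `x`: the initial order holds until
the two cross and is reversed afterwards. By transitivity everything below `i` is below `j`, and `i`
itself is one more. -/
theorem sweepPos_lt (hT : IsSweep T N) {x : ℕ} {i j : Fin ℓ} (hij : i ≠ j)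
    (h : i < j ↔ x ≤ T i j) : sweepPos T x i < sweepPos T x j := by
  classical
  refine Finset.card_lt_card ?_
  rw [Finset.ssubset_iff_of_subset]
  · exact ⟨i, by simp [hij, h], by simp⟩
  · intro k
    simp only [Finset.mem_filter, Finset.mem_univ, true_and]
    exact fun hk => hT.below_trans hk.1 hk.2 hij h

theorem sweepPos_injective (hT : IsSweep T N) (x : ℕ) : Function.Injective (sweepPos T x) := by
  intro i j hpos
  by_contra hij
  by_cases h : i < j ↔ x ≤ T i j
  · exact (hT.sweepPos_lt hij h).ne hpos
  · refine (hT.sweepPos_lt (x := x) (Ne.symm hij) ?_).ne hpos.symm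
    rw [hT.symm j i]
    rcases lt_or_gt_of_ne hij with h1 | h1
    · have := h1.not_gt
      tauto
    · have := h1.not_gt
      tauto

theorem sweepPos_lt_card (T : Fin ℓ → Fin ℓ → ℕ) (x : ℕ) (i : Fin ℓ) : sweepPos T x i < ℓ := by
  classical
  conv_rhs => rw [← Fintype.card_fin ℓ]
  exact Finset.card_lt_card ((Finset.ssubset_univ_iff).2 fun h => by
    simpa using Finset.ext_iff.1 h i)

theorem sweepPos_zero (T : Fin ℓ → Fin ℓ → ℕ) (i : Fin ℓ) : sweepPos T 0 i = i := by
  classical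
  rw [sweepPos]
  rw [← Fin.card_Iio i]
  congr 1
  ext k
  simp only [zero_le, iff_true, Finset.mem_filter, Finset.mem_univ, true_and, Finset.mem_Iio]
  exact ⟨And.right, fun h => ⟨h.ne, h⟩⟩

theorem below_succ_iff {x : ℕ} {k i : Fin ℓ} (h : T k i ≠ x) :
    (k < i ↔ x + 1 ≤ T k i) ↔ (k < i ↔ x ≤ T k i) := by
  rw [show x + 1 ≤ T k i ↔ x ≤ T k i by omega]

theorem sweepPos_succ_of_forall_ne {x : ℕ} {i : Fin ℓ} (h : ∀ k, k ≠ i → T k i ≠ x) :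
    sweepPos T (x + 1) i = sweepPos T x i := by
  classical
  rw [sweepPos, sweepPos]
  congr 1
  ext k
  simp only [Finset.mem_filter, Finset.mem_univ, true_and]
  exact and_congr_right fun hk => below_succ_iff (h k hk)

/-- At its crossing, a pair of pseudolines lies in the same way relative to every other one. -/
theorem below_iff_below (hT : IsSweep T N) {i j k : Fin ℓ} (hij : i < j) (hki : k ≠ i)
    (hkj : k ≠ j) : (k < i ↔ T i j ≤ T k i) ↔ (k < j ↔ T i j ≤ T k j) := by
  rcases lt_or_gt_of_ne hki with h1 | h1 <;> rcases lt_or_gt_of_ne hkj with h2 | h2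
  · have := hT.consistent k i j h1 hij
    simp only [h1, h2, true_iff] at *
    omega
  · exact absurd (h1.trans hij) h2.not_gt
  · have := hT.consistent i k j h1 h2
    rw [hT.symm k i] at *
    simp only [h1.not_gt, h2, true_iff, false_iff] at *
    omega
  · have := hT.consistent i j k hij h2
    rw [hT.symm k i, hT.symm k j] at *
    simp only [h1.not_gt, h2.not_gt, false_iff] at *
    omega

/-- A crossing swaps the positions of two adjacent pseudolines. -/
theorem sweepPos_crossing (hT : IsSweep T N) {i j : Fin ℓ} (hij : i < j) :
    sweepPos T (T i j) j = sweepPos T (T i j) i + 1 ∧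
      sweepPos T (T i j + 1) i = sweepPos T (T i j) j ∧
      sweepPos T (T i j + 1) j = sweepPos T (T i j) i := by
  classical
  have hT' : ∀ a b, T i j = T a b → (i = a ∧ j = b) ∨ (i = b ∧ j = a) ∨ a = b := by
    intro a b h
    rcases lt_trichotomy a b with h1 | h1 | h1
    · exact Or.inl (hT.injective _ _ _ _ hij h1 h)
    · exact Or.inr (Or.inr h1)
    · rw [hT.symm a b] at h
      exact Or.inr (Or.inl (hT.injective _ _ _ _ hij h1 h))
  have hj : sweepPos T (T i j) j = sweepPos T (T i j) i + 1 := by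
    rw [sweepPos, sweepPos, ← Finset.card_insert_of_notMem (a := i) (by simp)]
    congr 1
    ext k
    simp only [Finset.mem_filter, Finset.mem_univ, true_and, Finset.mem_insert]
    by_cases hki : k = i
    · subst hki
      simp [hij, hij.ne]
    by_cases hkj : k = j
    · subst hkj
      simp [hij.ne', hij.not_gt, hT.symm k i]
    simp only [hki, hkj, false_or, ne_eq, not_false_iff, true_and]
    exact (hT.below_iff_below hij hki hkj).symm
  refine ⟨hj, ?_, ?_⟩
  · rw [hj, sweepPos, sweepPos, ← Finset.card_insert_of_notMem (a := j)
      (by simp [hij.ne', hij.not_gt, hT.symm j i])]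
    congr 1
    ext k
    simp only [Finset.mem_filter, Finset.mem_univ, true_and, Finset.mem_insert]
    by_cases hki : k = i
    · subst hki
      simp [hij.ne]
    by_cases hkj : k = j
    · subst hkj
      simp [hij.ne', hij.not_gt, hT.symm k i]
    simp only [hki, hkj, false_or, ne_eq, not_false_iff, true_and]
    refine below_succ_iff fun h => ?_
    have := hT' k i h.symm
    have := hij.ne
    tauto
  · rw [sweepPos, sweepPos]
    congr 1
    ext k
    simp only [Finset.mem_filter, Finset.mem_univ, true_and]
    by_cases hki : k = i
    · subst hki
      simp [hij]
    by_cases hkj : k = j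
    · subst hkj
      simp [hij.ne', hij.not_gt, hT.symm k i]
    simp only [hki, hkj, ne_eq, not_false_iff, true_and]
    rw [hT.below_iff_below hij hki hkj]
    refine below_succ_iff fun h => ?_
    have := hT' k j h.symm
    have := hij.ne
    tauto

theorem sweepLevel_eq (hT : IsSweep T N) {i j : Fin ℓ} (hij : i < j) :
    sweepLevel T (T i j) = sweepPos T (T i j) i := by
  classical
  have h : ∃ a b, a < b ∧ T a b = T i j := ⟨i, j, hij, rfl⟩
  rw [sweepLevel, dif_pos h]
  obtain ⟨b, hb, hab⟩ := h.choose_spec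
  rw [(hT.injective _ _ _ _ hb hij hab).1]

theorem sweepPos_of_crossing (hT : IsSweep T N) {i j : Fin ℓ} (hij : i ≠ j) :
    (sweepLevel T (T i j) = sweepPos T (T i j) i ∨
      sweepLevel T (T i j) + 1 = sweepPos T (T i j) i) ∧
    (sweepLevel T (T i j) = sweepPos T (T i j + 1) i ∨
      sweepLevel T (T i j) + 1 = sweepPos T (T i j + 1) i) := by
  rcases lt_or_gt_of_ne hij with h | h
  · have h1 := hT.sweepPos_crossing h
    rw [hT.sweepLevel_eq h]
    omega
  · rw [hT.symm i j]
    have h1 := hT.sweepPos_crossing h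
    rw [hT.sweepLevel_eq h]
    omega

/-- Two crossings on the pseudoline `i`, with no crossing on `i` between them, are joined along a
track. -/
theorem exists_isTrackEdge (hT : IsSweep T N) {i a b : Fin ℓ} (hai : a ≠ i) (hbi : b ≠ i)
    (hab : T i a < T i b) (hbetween : ∀ c, c ≠ i → ¬ (T i a < T i c ∧ T i c < T i b)) :
    ∃ τ, IsTrackEdge (sweepLevel T) (T i a) (T i b) τ := by
  -- Without a crossing on `i` its position does not change; this constant position is the track of
  -- the edge.
  have hpos : ∀ u, T i a < u → u ≤ T i b → sweepPos T u i = sweepPos T (T i a + 1) i := by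
    intro u hu
    induction u, hu using Nat.le_induction with
    | base => exact fun _ => rfl
    | succ u hu ih =>
      intro hub
      rw [sweepPos_succ_of_forall_ne, ih (by omega)]
      intro c hc h
      refine hbetween c hc ?_
      rw [hT.symm i c, h]
      exact ⟨hu, hub⟩
  refine ⟨sweepPos T (T i a + 1) i, hab.ne, (hT.sweepPos_of_crossing hai.symm).2, ?_, ?_⟩
  · rw [← hpos (T i b) hab le_rfl]
    exact (hT.sweepPos_of_crossing hbi.symm).1
  · rw [min_eq_left hab.le, max_eq_right hab.le]
    intro u hu1 hu2
    obtain ⟨c, d, hcd, rfl⟩ := hT.exists_eq u (hu2.trans (hT.lt i b hbi.symm))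
    have hci : c ≠ i := by
      rintro rfl
      exact hbetween d hcd.ne' ⟨hu1, hu2⟩
    have hdi : d ≠ i := by
      rintro rfl
      rw [hT.symm c d] at hu1 hu2
      exact hbetween c hcd.ne ⟨hu1, hu2⟩
    rw [← hpos _ hu1 hu2.le, hT.sweepLevel_eq hcd, ← (hT.sweepPos_crossing hcd).1]
    exact ⟨fun h => hci (hT.sweepPos_injective _ h), fun h => hdi (hT.sweepPos_injective _ h)⟩

theorem sweepLevel_lt (hT : IsSweep T N) {x : ℕ} (hx : x < N) : sweepLevel T x < ℓ - 1 := by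
  obtain ⟨i, j, hij, rfl⟩ := hT.exists_eq x hx
  have h1 := (hT.sweepPos_crossing hij).1
  have h2 := sweepPos_lt_card T (T i j) j
  rw [hT.sweepLevel_eq hij]
  omega

/-- The crossings of a sweep form a wiring diagram. -/
theorem exists_wiringDiagram (hT : IsSweep T N) :
    ∃ D : WiringDiagram ℓ, ∀ t : Fin (ℓ - 1),
      ((Finset.range N).filter fun x => sweepLevel T x = t).card = D.levels.count t := by
  let w : List (Fin (ℓ - 1)) := List.ofFn fun x : Fin N => ⟨sweepLevel T x, hT.sweepLevel_lt x.2⟩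
  have hlen : w.length = N := by simp [w]
  have hget : ∀ x (hx : x < w.length), (w[x] : ℕ) = sweepLevel T x := by
    intro x hx
    simp [w]
  -- The invariant of the sweep: after `x` crossings the track assignment is inverse to `sweepPos T
  -- x`.
  have hocc : ∀ x ≤ N, ∀ i : Fin ℓ,
      trackOccupant (w.take x) ⟨sweepPos T x i, sweepPos_lt_card T x i⟩ = i := by
    intro x
    induction x with
    | zero =>
      intro _ i
      simp [trackOccupant, sweepPos_zero]
    | succ x ih =>
      intro hx k
      have hxl : x < w.length := by omega
      rw [List.take_succ_eq_append_getElem hxl, trackOccupant, List.map_append, List.prod_append,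
        List.map_singleton, List.prod_singleton, Equiv.Perm.mul_apply]
      refine Eq.trans ?_ (ih (by omega) k)
      rw [← trackOccupant]
      congr 1
      obtain ⟨i, j, hij, hx'⟩ := hT.exists_eq x (by omega)
      have hc := hT.sweepPos_crossing hij
      have hl := hT.sweepLevel_eq hij
      rw [hx'] at hc hl
      have hlo : lowerTrack w[x] = ⟨sweepPos T x i, sweepPos_lt_card T x i⟩ :=
        Fin.ext ((hget x hxl).trans hl)
      have hup : upperTrack w[x] = ⟨sweepPos T x j, sweepPos_lt_card T x j⟩ :=
        Fin.ext (by simp [upperTrack, hget x hxl, hl, hc.1])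
      rw [hlo, hup]
      by_cases hki : k = i
      · subst hki
        simp only [hc.2.1, Equiv.swap_apply_right]
      by_cases hkj : k = j
      · subst hkj
        simp only [hc.2.2, Equiv.swap_apply_left]
      have hk : sweepPos T (x + 1) k = sweepPos T x k := by
        refine sweepPos_succ_of_forall_ne fun c hc h => ?_
        rcases lt_or_gt_of_ne hc with h1 | h1
        · exact hkj (hT.injective _ _ _ _ hij h1 (hx'.trans h.symm)).2.symm
        · rw [hT.symm] at h
          exact hki (hT.injective _ _ _ _ hij h1 (hx'.trans h.symm)).1.symm
      simp only [hk]
      refine Equiv.swap_apply_of_ne_of_ne ?_ ?_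
      · exact fun h => hki (hT.sweepPos_injective x (Fin.mk.inj h))
      · exact fun h => hkj (hT.sweepPos_injective x (Fin.mk.inj h))
  have hpair : ∀ (k : Fin w.length) (i j : Fin ℓ), i < j → T i j = k →
      crossingPair w k = s(i, j) := by
    intro k i j hij hk
    have hkN : (k : ℕ) < N := hlen ▸ k.2
    have hc := hT.sweepPos_crossing hij
    have hl := hT.sweepLevel_eq hij
    rw [hk] at hc hl
    have hlo : lowerTrack (w.get k) = ⟨sweepPos T k i, sweepPos_lt_card T k i⟩ :=
      Fin.ext ((hget k k.2).trans hl)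
    have hup : upperTrack (w.get k) = ⟨sweepPos T k j, sweepPos_lt_card T k j⟩ :=
      Fin.ext (by simp [upperTrack, hget k k.2, hl, hc.1])
    rw [crossingPair, hlo, hup, hocc k hkN.le, hocc k hkN.le]
  have honce : ∀ i j : Fin ℓ, i < j → ∃! k : Fin w.length, crossingPair w k = s(i, j) := by
    intro i j hij
    refine ⟨⟨T i j, hlen ▸ hT.lt i j hij.ne⟩, hpair _ i j hij rfl, fun k hk => ?_⟩
    obtain ⟨a, b, hab, habk⟩ := hT.exists_eq k (hlen ▸ k.2)
    replace hk : crossingPair w k = s(i, j) := hk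
    rw [hpair k a b hab habk, Sym2.eq_iff] at hk
    apply Fin.ext
    rw [← habk]
    rcases hk with ⟨rfl, rfl⟩ | ⟨rfl, rfl⟩
    · rfl
    · exact hT.symm _ _
  refine ⟨⟨w, fun i j hij => ?_⟩, fun t => ?_⟩
  · rcases lt_or_gt_of_ne hij with h | h
    · exact honce i j h
    · rw [Sym2.eq_swap]
      exact honce j i h
  · have hcount : ∀ x ≤ N,
        ((Finset.range x).filter fun r => sweepLevel T r = t).card = (w.take x).count t := by
      intro x
      induction x with
      | zero => simp
      | succ x ih =>
        intro hx
        have hxl : x < w.length := by omega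
        rw [List.take_succ_eq_append_getElem hxl, List.count_append, ← ih (by omega),
          Finset.range_add_one, Finset.filter_insert, List.count_singleton]
        have hiff : sweepLevel T x = t ↔ w[x] = t := by rw [Fin.ext_iff, hget x hxl]
        by_cases h : sweepLevel T x = t
        · rw [if_pos h, Finset.card_insert_of_notMem (by simp), if_pos (by simpa using hiff.1 h)]
        · rw [if_neg h, if_neg (by simpa using fun h' => h (hiff.2 h')), add_zero]
    rw [hcount N le_rfl, List.take_of_length_le hlen.le]

end IsSweep

/-! ### From arrangements to sweeps. -/

/-- The crossings of a simple arrangement are swept in an order for which the edges of the arrangement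
graph join consecutive crossings of a pseudoline. -/
theorem IsSimpleArrangement.exists_sweep {ℓ : ℕ} {L : Fin ℓ → Set (ℝ × ℝ)}
    (hL : IsSimpleArrangement L) :
    ∃ T : Fin ℓ → Fin ℓ → ℕ, IsSweep T (ℓ * (ℓ - 1) / 2) ∧
      ∃ s : crossingPoints L ≃ Fin (ℓ * (ℓ - 1) / 2), ∀ p q, (arrangementGraph L).Adj p q →
        ∃ τ, IsTrackEdge (sweepLevel T) (s p) (s q) τ := by
  obtain ⟨h, t, P, hh, hmem, heq, hne, hP⟩ := hL.exists_parameters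
  obtain ⟨u, e, hu, hue⟩ := exists_consistent_labeling hne hP
  have hune : ∀ i j k, i ≠ j → i ≠ k → j ≠ k → u i j ≠ u i k := by
    intro i j k hij hik hjk
    rcases hu i with h | h <;> simp [h, hne i j k hij hik hjk]
  obtain ⟨T, hT, hTu⟩ := exists_isSweep (t := fun i j => u (e i) (e j))
    (fun i j k hij hik hjk => hune _ _ _ (e.injective.ne hij) (e.injective.ne hik)
      (e.injective.ne hjk)) hue
  have hpoint : ∀ i j, i ≠ j → ∀ p, p ∈ L i → p ∈ L j → p = h i (t i j, 0) := by
    intro i j hij p hi hj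
    rw [← hh i] at hi
    obtain ⟨⟨x, y⟩, rfl : y = 0, rfl⟩ := hi
    rw [(hmem i j hij x).1 hj]
  have hmemL : ∀ i x, h i (x, 0) ∈ L i := fun i x => by
    rw [← hh i]; exact mem_image_of_mem _ rfl
  have hpair : ∀ p : crossingPoints L, ∃ i j, i < j ∧ (p : ℝ × ℝ) ∈ L (e i) ∧
      (p : ℝ × ℝ) ∈ L (e j) := by
    rintro ⟨p, i, j, hij, hi, hj⟩
    rcases lt_or_gt_of_ne (e.symm.injective.ne hij) with h | h
    · exact ⟨e.symm i, e.symm j, h, by simpa using hi, by simpa using hj⟩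
    · exact ⟨e.symm j, e.symm i, h, by simpa using hj, by simpa using hi⟩
  choose I J hIJ hI hJ using hpair
  have htime : ∀ (p : crossingPoints L) (i j : Fin ℓ), i ≠ j → (p : ℝ × ℝ) ∈ L (e i) →
      (p : ℝ × ℝ) ∈ L (e j) → T (I p) (J p) = T i j := by
    intro p
    -- By simplicity a crossing determines its two pseudolines, and hence its time.
    have hline : ∀ k, (p : ℝ × ℝ) ∈ L (e k) → k = I p ∨ k = J p := by
      intro k hk
      by_contra! hne
      have : (p : ℝ × ℝ) ∈ L (e (I p)) ∩ L (e (J p)) ∩ L (e k) := ⟨⟨hI p, hJ p⟩, hk⟩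
      rw [hL.simple _ _ _ (e.injective.ne (hIJ p).ne) (e.injective.ne hne.1.symm)
        (e.injective.ne hne.2.symm)] at this
      exact this
    intro i j hij hi hj
    rcases hline i hi with rfl | rfl <;> rcases hline j hj with h | h
    · exact absurd h.symm hij
    · rw [h]
    · rw [h, hT.symm]
    · exact absurd h.symm hij
  let s : crossingPoints L → Fin (ℓ * (ℓ - 1) / 2) := fun p =>
    ⟨T (I p) (J p), hT.lt _ _ (hIJ p).ne⟩
  have hs : Function.Bijective s := by
    constructor
    · intro p q hpq
      obtain ⟨h1, h2⟩ := hT.injective _ _ _ _ (hIJ p) (hIJ q) (Fin.mk.inj hpq)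
      have hne' := e.injective.ne (hIJ p).ne
      apply Subtype.ext
      rw [hpoint _ _ hne' p (hI p) (hJ p), hpoint _ _ hne' q (h1 ▸ hI q) (h2 ▸ hJ q)]
    · intro x
      obtain ⟨i, j, hij, hx⟩ := hT.exists_eq x x.2
      have hne' := e.injective.ne hij.ne
      have h1 := hmemL (e i) (t (e i) (e j))
      have h2 := (hmem _ _ hne' _).2 rfl
      exact ⟨⟨h (e i) (t (e i) (e j), 0), e i, e j, hne', h1, h2⟩,
        Fin.ext ((htime _ i j hij.ne h1 h2).trans hx)⟩
  refine ⟨T, hT, Equiv.ofBijective s hs, ?_⟩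
  have hother : ∀ (p : crossingPoints L) (i : Fin ℓ),
      ∃ a, a ≠ i ∧ (p : ℝ × ℝ) ∈ L (e a) := by
    intro p i
    by_cases hi : I p = i
    · exact ⟨J p, fun h => (hIJ p).ne (hi.trans h.symm), hJ p⟩
    · exact ⟨I p, hi, hI p⟩
  rintro p q ⟨hpq, i', g, a', b', hg, hga, hgb, hfree⟩
  obtain ⟨i, rfl⟩ := e.surjective i'
  have hgL : ∀ x : ℝ, g (x, 0) ∈ L (e i) := fun x => by
    rw [← hg]; exact mem_image_of_mem _ rfl
  obtain ⟨a, hai, ha⟩ := hother p i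
  obtain ⟨b, hbi, hb⟩ := hother q i
  have hsp : (s p : ℕ) = T i a := htime p i a hai.symm (hga ▸ hgL a') ha
  have hsq : (s q : ℕ) = T i b := htime q i b hbi.symm (hgb ▸ hgL b') hb
  have hab : a ≠ b := by
    rintro rfl
    exact hpq (hs.1 (Fin.ext (hsp.trans hsq.symm)))
  -- Adjacency is witnessed by some parametrization `g`, not necessarily by `h (e i)`. The change of
  -- parameter `φ` is continuous, so by the intermediate value theorem a crossing between the two
  -- ends for `h (e i)` is also one for `g`.
  have hfree' : ∀ c, c ≠ i → c ≠ a → c ≠ b →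
      t (e i) (e c) ∉ uIcc (t (e i) (e a)) (t (e i) (e b)) := by
    intro c hci hca hcb hc
    let φ : ℝ → ℝ := fun x => ((h (e i)).symm (g (x, 0))).1
    have hφ : Continuous φ := by fun_prop
    have hφ' : ∀ x, g (x, 0) = h (e i) (φ x, 0) := by
      intro x
      have hz := (mem_image_horizontalAxis (hh (e i)) _).1 (hgL x)
      rw [show (φ x, (0 : ℝ)) = (h (e i)).symm (g (x, 0)) from Prod.ext rfl hz.symm,
        Homeomorph.apply_symm_apply]
    have hval : ∀ x d, d ≠ i → g (x, 0) ∈ L (e d) → φ x = t (e i) (e d) := by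
      intro x d hd hx
      rw [hφ'] at hx
      exact (hmem _ _ (e.injective.ne hd.symm) _).1 hx
    have hφa := hval a' a hai (hga ▸ ha)
    have hφb := hval b' b hbi (hgb ▸ hb)
    rw [← hφa, ← hφb] at hc
    obtain ⟨x, hx, hxc⟩ := intermediate_value_uIcc hφ.continuousOn hc
    have n1 := hne _ _ _ (e.injective.ne hci.symm) (e.injective.ne hai.symm) (e.injective.ne hca)
    have n2 := hne _ _ _ (e.injective.ne hci.symm) (e.injective.ne hbi.symm) (e.injective.ne hcb)
    have hxa : x ≠ a' := by
      rintro rfl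
      exact n1 (hxc.symm.trans hφa)
    have hxb : x ≠ b' := by
      rintro rfl
      exact n2 (hxc.symm.trans hφb)
    have hx' : x ∈ uIoo a' b' := by
      rcases mem_uIcc.1 hx with hx | hx
      · exact mem_uIoo_of_lt (lt_of_le_of_ne hx.1 hxa.symm) (lt_of_le_of_ne hx.2 hxb)
      · exact mem_uIoo_of_gt (lt_of_le_of_ne hx.1 hxb.symm) (lt_of_le_of_ne hx.2 hxa)
    refine hfree x hx' ⟨e i, e c, e.injective.ne hci.symm, hgL x, ?_⟩
    rw [hφ', hxc]
    exact (hmem _ _ (e.injective.ne hci.symm) _).2 rfl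
  have hbetween : ∀ c, c ≠ i → ¬ (T i a < T i c ∧ T i c < T i b) ∧
      ¬ (T i b < T i c ∧ T i c < T i a) := by
    intro c hci
    by_cases hca : c = a
    · subst hca; simp
    by_cases hcb : c = b
    · subst hcb; simp
    have h1 := hfree' c hci hca hcb
    rw [hTu i a c hai.symm hci.symm (Ne.symm hca), hTu i c b hci.symm hbi.symm hcb,
      hTu i b c hbi.symm hci.symm (Ne.symm hcb), hTu i c a hci.symm hai.symm hca]
    rw [mem_uIcc] at h1
    push Not at h1
    rcases hu (e i) with h | h <;> simp only [h, Pi.neg_apply, neg_lt_neg_iff] <;>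
      constructor <;> rintro ⟨h2, h3⟩
    · exact (h1.1 h2.le).not_gt h3
    · exact (h1.2 h2.le).not_gt h3
    · exact (h1.2 h3.le).not_gt h2
    · exact (h1.1 h3.le).not_gt h2
  simp only [Equiv.ofBijective_apply]
  rw [hsp, hsq]
  have hneT : T i a ≠ T i b := fun h => hpq (hs.1 (Fin.ext (hsp.trans (h.trans hsq.symm))))
  rcases lt_or_gt_of_ne hneT with hlt | hlt
  · exact hT.exists_isTrackEdge hai hbi hlt fun c hc => (hbetween c hc).1
  · obtain ⟨τ, hτ⟩ := hT.exists_isTrackEdge hbi hai hlt fun c hc => (hbetween c hc).2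
    exact ⟨τ, hτ.symm⟩

/-! ### The sequence `ξ`. -/

theorem xiSeq_two_mul {i : ℕ} (hi : 0 < i) : xiSeq (2 * i) = 2 * xiSeq i + 1 := by
  unfold xiSeq
  have h1 := Nat.xor_div_two (a := 2 * i) (b := 2 * i - 1)
  have h2 := Nat.xor_mod_two_eq (m := 2 * i) (n := 2 * i - 1)
  rw [show 2 * i / 2 = i by omega, show (2 * i - 1) / 2 = i - 1 by omega] at h1
  omega

theorem xiSeq_two_mul_add_one (i : ℕ) : xiSeq (2 * i + 1) = 1 := by
  unfold xiSeq
  have h1 := Nat.xor_div_two (a := 2 * i + 1) (b := 2 * i + 1 - 1)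
  have h2 := Nat.xor_mod_two_eq (m := 2 * i + 1) (n := 2 * i + 1 - 1)
  rw [show (2 * i + 1) / 2 = i by omega, show (2 * i + 1 - 1) / 2 = i by omega,
    Nat.xor_self] at h1
  omega

/-- Doubling the index appends a binary digit `1` to `ξ`, so `k` factors of `2` give at least `k +
1` ones. -/
theorem two_pow_le_xiSeq (k : ℕ) : ∀ m, 0 < m → 2 ^ (k + 1) ≤ xiSeq (2 ^ k * m) + 1 := by
  induction k with
  | zero =>
    intro m hm
    rcases Nat.even_or_odd' m with ⟨j, rfl | rfl⟩
    · rw [pow_zero, one_mul, xiSeq_two_mul (by omega)]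
      omega
    · rw [pow_zero, one_mul, xiSeq_two_mul_add_one, zero_add, pow_one]
  | succ k ih =>
    intro m hm
    rw [show 2 ^ (k + 1) * m = 2 * (2 ^ k * m) by ring, xiSeq_two_mul (by positivity)]
    have := ih m hm
    rw [pow_succ]
    omega

/-- Every sequence of positive numbers is dominated by a subsequence of `xiSeq`, whose indices are
bounded by the partial sums of the sequence. -/
theorem exists_strictMono_le_xiSeq {d : ℕ → ℕ} (hd : ∀ t, 0 < d t) :
    ∃ row : ℕ → ℕ, StrictMono row ∧ ∀ t, 0 < row t ∧
      row t ≤ ∑ r ∈ Finset.range (t + 1), d r ∧ d t ≤ xiSeq (row t) := by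
  have key : ∀ t, ∃ x, ∑ r ∈ Finset.range t, d r < x ∧
      x ≤ ∑ r ∈ Finset.range (t + 1), d r ∧ d t ≤ xiSeq x := by
    intro t
    set a := ∑ r ∈ Finset.range t, d r with ha
    set k := Nat.log 2 (d t) with hk
    have h1 : 2 ^ k ≤ d t := Nat.pow_log_le_self 2 (hd t).ne'
    have h2 : d t < 2 ^ (k + 1) := Nat.lt_pow_succ_log_self one_lt_two _
    -- The first multiple of `2 ^ k` beyond the partial sum `a`: it exceeds `a` by at most `2 ^ k ≤
    -- d t`, and its `ξ` is at least `2 ^ (k + 1) - 1 ≥ d t`.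
    refine ⟨2 ^ k * (a / 2 ^ k + 1), Nat.lt_mul_div_succ a (by positivity), ?_, ?_⟩
    · rw [Finset.sum_range_succ, ← ha, mul_add, mul_one]
      exact add_le_add (Nat.mul_div_le _ _) h1
    · have := two_pow_le_xiSeq k (a / 2 ^ k + 1) (Nat.succ_pos _)
      omega
  choose row h1 h2 h3 using key
  exact ⟨row, strictMono_nat_of_lt_succ fun t => (h2 t).trans_lt (h1 (t + 1)),
    fun t => ⟨(Nat.zero_le _).trans_lt (h1 t), h2 t, h3 t⟩⟩

/-- Odd indices contribute `1` each and an even index `2 * i` contributes `2 * ξ i + 1`, so the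
partial sums satisfy `S (2 * m) = 2 * S m + 2 * m`, a recurrence of type `m log m`. -/
theorem sum_xiSeq_le (m : ℕ) :
    ∑ i ∈ Finset.Icc 1 m, xiSeq i ≤ m * (2 * Nat.log 2 m + 1) := by
  have hdouble : ∀ m, ∑ i ∈ Finset.Icc 1 (2 * m), xiSeq i =
      2 * ∑ i ∈ Finset.Icc 1 m, xiSeq i + 2 * m := by
    intro m
    induction m with
    | zero => simp
    | succ m ih =>
      rw [show 2 * (m + 1) = 2 * m + 1 + 1 by ring, Finset.sum_Icc_succ_top (by omega),
        Finset.sum_Icc_succ_top (by omega), Finset.sum_Icc_succ_top (by omega), ih,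
        xiSeq_two_mul_add_one, show 2 * m + 1 + 1 = 2 * (m + 1) by ring,
        xiSeq_two_mul (by omega)]
      ring
  induction m using Nat.strong_induction_on with
  | _ m ih =>
    rcases Nat.even_or_odd' m with ⟨j, rfl | rfl⟩
    · rcases Nat.eq_zero_or_pos j with rfl | hj
      · simp
      rw [hdouble, mul_comm 2 j, Nat.log_mul_base one_lt_two hj.ne']
      have := ih j (by omega)
      nlinarith
    · rw [Finset.sum_Icc_succ_top (by omega), hdouble, xiSeq_two_mul_add_one]
      rcases Nat.eq_zero_or_pos j with rfl | hj
      · simp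
      have h1 := ih j (by omega)
      have h2 : Nat.log 2 j + 1 ≤ Nat.log 2 (2 * j + 1) := by
        rw [← Nat.log_mul_base one_lt_two hj.ne']
        exact Nat.log_mono_right (by omega)
      nlinarith

/-! ### The universal point sets and their size. -/

/-- The universal point set for the graphs of arrangements of `ℓ` pseudolines. -/
noncomputable def arrangementPoints (ℓ : ℕ) : Finset (ℕ × ℕ) :=
  (Finset.Icc 1 (kappaMax ℓ) ×ˢ Finset.Icc 1 (3 * (ℓ - 1) / 2)).filter
    fun p => p.1 ≤ ℓ * xiSeq p.2

theorem mem_arrangementPoints {ℓ : ℕ} {p : ℕ × ℕ} :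
    p ∈ arrangementPoints ℓ ↔ 1 ≤ p.1 ∧ p.1 ≤ min (ℓ * xiSeq p.2) (kappaMax ℓ) ∧
      p.2 ∈ Finset.Icc 1 (3 * (ℓ - 1) / 2) := by
  simp only [arrangementPoints, Finset.mem_filter, Finset.mem_product, Finset.mem_Icc, le_min_iff]
  tauto

theorem card_filter_arrangementPoints {ℓ i : ℕ} (hi : i ∈ Finset.Icc 1 (3 * (ℓ - 1) / 2)) :
    ((arrangementPoints ℓ).filter fun p => p.2 = i).card =
      min (ℓ * xiSeq i) (kappaMax ℓ) := by
  have : (arrangementPoints ℓ).filter (fun p => p.2 = i) =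
      Finset.Icc 1 (min (ℓ * xiSeq i) (kappaMax ℓ)) ×ˢ {i} := by
    ext ⟨x, y⟩
    simp only [Finset.mem_filter, mem_arrangementPoints, Finset.mem_product, Finset.mem_singleton,
      Finset.mem_Icc (a := 1) (b := min _ _)]
    constructor
    · rintro ⟨⟨h1, h2, -⟩, rfl⟩
      exact ⟨⟨h1, h2⟩, rfl⟩
    · rintro ⟨⟨h1, h2⟩, rfl⟩
      exact ⟨⟨h1, h2, hi⟩, rfl⟩
  rw [this, Finset.card_product, Finset.card_singleton, mul_one, Nat.card_Icc, Nat.add_sub_cancel]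

theorem card_arrangementPoints_le (ℓ : ℕ) :
    (arrangementPoints ℓ).card ≤
      ℓ * (3 * (ℓ - 1) / 2 * (2 * Nat.log 2 (3 * (ℓ - 1) / 2) + 1)) := by
  rw [Finset.card_eq_sum_card_fiberwise (t := Finset.Icc 1 (3 * (ℓ - 1) / 2)) (f := Prod.snd)
    (fun p hp => (mem_arrangementPoints.1 hp).2.2)]
  calc _ ≤ ∑ i ∈ Finset.Icc 1 (3 * (ℓ - 1) / 2), ℓ * xiSeq i :=
        Finset.sum_le_sum fun i hi =>
          (card_filter_arrangementPoints hi).trans_le (min_le_left _ _)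
    _ ≤ _ := by
      rw [← Finset.mul_sum]
      exact Nat.mul_le_mul_left _ (sum_xiSeq_le _)

/-- The drawing of the graph of an arrangement at points of the universal set. -/
theorem IsSimpleArrangement.exists_drawing {ℓ : ℕ} {L : Fin ℓ → Set (ℝ × ℝ)}
    (hL : IsSimpleArrangement L) :
    ∃ f : crossingPoints L → ℝ × ℝ,
      (∀ v, f v ∈ gridPoint '' (arrangementPoints ℓ : Set (ℕ × ℕ))) ∧
        IsPlanarStraightLineDrawing (arrangementGraph L) f := by
  obtain ⟨T, hT, s, hs⟩ := hL.exists_sweep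
  obtain ⟨D, hD⟩ := hT.exists_wiringDiagram
  let c : ℕ → ℕ := fun t =>
    ((Finset.range (ℓ * (ℓ - 1) / 2)).filter fun x => sweepLevel T x = t).card
  -- A level with `c t` crossings fits into `c t / ℓ + 1` blocks of `ℓ` points; the `+ 1` covers the
  -- remainder and keeps the demand positive.
  obtain ⟨row, hrow, hrow'⟩ := exists_strictMono_le_xiSeq (d := fun t => c t / ℓ + 1)
    (fun t => Nat.succ_pos _)
  have htotal : ∑ t ∈ Finset.range (ℓ - 1), c t = ℓ * (ℓ - 1) / 2 := by
    conv_rhs => rw [← Finset.card_range (ℓ * (ℓ - 1) / 2)]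
    exact (Finset.card_eq_sum_card_fiberwise fun x hx => by
      simpa using hT.sweepLevel_lt (Finset.mem_range.1 hx)).symm
  -- The quotients add up to at most `(ℓ - 1) / 2`, since the `c t` have total `ℓ * (ℓ - 1) / 2`,
  -- and the summands `1` add `ℓ - 1`.
  have hsum : ∑ t ∈ Finset.range (ℓ - 1), (c t / ℓ + 1) ≤ 3 * (ℓ - 1) / 2 := by
    rcases Nat.eq_zero_or_pos ℓ with rfl | hℓ
    · simp
    rw [Finset.sum_add_distrib, Finset.sum_const, Finset.card_range, smul_eq_mul, mul_one]
    have h1 : ℓ * ∑ t ∈ Finset.range (ℓ - 1), c t / ℓ ≤ ℓ * (ℓ - 1) / 2 := by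
      rw [← htotal, Finset.mul_sum]
      exact Finset.sum_le_sum fun t _ => Nat.mul_div_le _ _
    have h2 : 2 * ∑ t ∈ Finset.range (ℓ - 1), c t / ℓ ≤ ℓ - 1 := by
      refine Nat.le_of_mul_le_mul_left ?_ hℓ
      calc _ = 2 * (ℓ * ∑ t ∈ Finset.range (ℓ - 1), c t / ℓ) := by ring
        _ ≤ 2 * (ℓ * (ℓ - 1) / 2) := Nat.mul_le_mul_left _ h1
        _ ≤ _ := Nat.mul_div_le _ _
    omega
  refine ⟨_, fun v => mem_image_of_mem _ ?_,
    isPlanarStraightLineDrawing_levelPoint hrow (Fin.val_injective.comp s.injective) hs⟩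
  have hv := (s v).2
  simp only [Function.comp_apply]
  generalize ((s v : Fin _) : ℕ) = x at hv
  have hlev := hT.sweepLevel_lt hv
  have hx : (levelPoint (sweepLevel T) row x).1 ≤ c (sweepLevel T x) := by
    change 1 + _ ≤ _
    rw [add_comm, ← Finset.card_insert_of_notMem (a := x) (by simp)]
    refine Finset.card_le_card fun r hr => ?_
    simp only [Finset.mem_insert, Finset.mem_filter, Finset.mem_range] at hr ⊢
    rcases hr with rfl | hr
    · exact ⟨hv, rfl⟩
    · exact ⟨hr.1.trans hv, hr.2⟩
  have hkappa : c (sweepLevel T x) ≤ kappaMax ℓ := by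
    calc c (sweepLevel T x) = D.levels.count ⟨sweepLevel T x, hlev⟩ := hD ⟨_, hlev⟩
      _ ≤ D.complexity :=
        Finset.le_sup (f := fun t : Fin (ℓ - 1) => D.levels.count t) (Finset.mem_univ _)
      _ ≤ kappaMax ℓ := le_ciSup (bddAbove_complexity ℓ) D
  obtain ⟨hr1, hr2, hr3⟩ := hrow' (sweepLevel T x)
  have hxi : c (sweepLevel T x) ≤ ℓ * xiSeq (row (sweepLevel T x)) :=
    (Nat.lt_mul_div_succ _ (by omega)).le.trans (Nat.mul_le_mul_left _ hr3)
  refine mem_arrangementPoints.2 ⟨Nat.le_add_right _ _,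
    le_min (hx.trans hxi) (hx.trans hkappa), Finset.mem_Icc.2 ⟨hr1, hr2.trans (le_trans ?_ hsum)⟩⟩
  exact Finset.sum_le_sum_of_subset (Finset.range_mono hlev)

/-- The number of pseudolines with `n` crossings (and `0` if there is none). -/
noncomputable def numPseudolines (n : ℕ) : ℕ :=
  open Classical in if h : ∃ ℓ, n = ℓ * (ℓ - 1) / 2 then h.choose else 0

/-- The number of crossings determines `ℓ` except for `ℓ = 0` and `ℓ = 1`, and both of these give
the empty set. -/
theorem arrangementPoints_numPseudolines (ℓ : ℕ) :
    arrangementPoints (numPseudolines (ℓ * (ℓ - 1) / 2)) = arrangementPoints ℓ := by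
  have h : ∃ m, ℓ * (ℓ - 1) / 2 = m * (m - 1) / 2 := ⟨ℓ, rfl⟩
  rw [numPseudolines, dif_pos h]
  have hm := h.choose_spec
  generalize h.choose = m at hm
  have hmono : ∀ a b, 1 ≤ a → a < b → a * (a - 1) / 2 < b * (b - 1) / 2 := by
    intro a b ha hab
    rw [← Finset.sum_range_id, ← Finset.sum_range_id]
    exact Finset.sum_lt_sum_of_subset (i := a) (Finset.range_mono hab.le) (by simpa using hab)
      (by simp) (by omega) (by simp)
  have hsmall : ∀ a, a ≤ 1 → arrangementPoints a = ∅ := by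
    intro a ha
    interval_cases a <;> simp [arrangementPoints]
  by_cases h1 : ℓ ≤ 1
  · have h2 : m ≤ 1 := by
      by_contra! h2
      have := hmono 1 m le_rfl h2
      interval_cases ℓ <;> simp at hm this <;> omega
    rw [hsmall ℓ h1, hsmall m h2]
  · have h2 : ¬ m ≤ 1 := by
      intro h2
      have := hmono 1 ℓ le_rfl (by omega)
      interval_cases m <;> simp at hm this <;> omega
    rcases lt_trichotomy ℓ m with h3 | rfl | h3
    · exact absurd hm (hmono ℓ m (by omega) h3).ne
    · rfl
    · exact absurd hm.symm (hmono m ℓ (by omega) h3).ne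

theorem card_arrangementPoints_isBigO :
    (fun n : ℕ => ((arrangementPoints (numPseudolines n)).card : ℝ)) =O[atTop]
      fun n : ℕ => (n : ℝ) * Real.log n := by
  -- With `s` rows, `18 = 3 * 6` comes from `ℓ * s ≤ 3 * n` and, by `s ≤ n ^ 2`, from `(2 * Nat.log
  -- 2 s + 1) * log 2 ≤ 4 * log n + log 2 ≤ 6 * log n`.
  refine IsBigO.of_bound (18 / Real.log 2) ?_
  filter_upwards [eventually_ge_atTop 2] with n hn
  have hlog2 : 0 < Real.log 2 := Real.log_pos one_lt_two
  have hnR : (2 : ℝ) ≤ n := by exact_mod_cast hn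
  have hlogn : Real.log 2 ≤ Real.log n := Real.log_le_log two_pos hnR
  rw [Real.norm_of_nonneg (Nat.cast_nonneg _),
    Real.norm_of_nonneg (mul_nonneg (Nat.cast_nonneg _) (hlog2.le.trans hlogn))]
  by_cases hex : ∃ ℓ, n = ℓ * (ℓ - 1) / 2
  swap
  · rw [numPseudolines, dif_neg hex]
    have : arrangementPoints 0 = ∅ := by simp [arrangementPoints]
    rw [this, Finset.card_empty, Nat.cast_zero]
    have := hlog2.le.trans hlogn
    positivity
  obtain ⟨ℓ, hℓ⟩ := hex
  have hℓ2 : 2 ≤ ℓ := by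
    by_contra! h
    interval_cases ℓ <;> simp at hℓ <;> omega
  have heven : ℓ * (ℓ - 1) = 2 * n := by
    rw [hℓ]
    exact (Nat.mul_div_cancel' (Nat.even_mul_pred_self ℓ).two_dvd).symm
  set s := 3 * (ℓ - 1) / 2 with hs
  have hspos : s ≠ 0 := by omega
  have hls : ℓ * s ≤ 3 * n := by
    have h1 : 2 * s ≤ 3 * (ℓ - 1) := Nat.mul_div_le _ _
    have := Nat.mul_le_mul_left ℓ h1
    nlinarith
  have hsn : s ≤ n ^ 2 := by
    have h1 : ℓ - 1 ≤ n := by nlinarith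
    nlinarith [Nat.mul_div_le (3 * (ℓ - 1)) 2]
  have hcard : ((arrangementPoints (numPseudolines n)).card : ℝ) ≤
      3 * n * (2 * Nat.log 2 s + 1) := by
    have h1 := card_arrangementPoints_le ℓ
    rw [← arrangementPoints_numPseudolines, ← hℓ, ← hs, ← mul_assoc] at h1
    exact_mod_cast h1.trans (Nat.mul_le_mul_right _ hls)
  have hlog : (Nat.log 2 s : ℝ) * Real.log 2 ≤ 2 * Real.log n := by
    rw [← Real.log_pow]
    have h1 : ((2 ^ Nat.log 2 s : ℕ) : ℝ) ≤ (n : ℝ) ^ 2 := by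
      exact_mod_cast (Nat.pow_log_le_self 2 hspos).trans hsn
    calc Real.log (2 ^ Nat.log 2 s) ≤ Real.log ((n : ℝ) ^ 2) :=
          Real.log_le_log (by positivity) (by exact_mod_cast h1)
      _ = _ := by rw [Real.log_pow]; norm_num
  refine hcard.trans ?_
  rw [div_mul_eq_mul_div, le_div_iff₀ hlog2]
  have : (2 * (Nat.log 2 s : ℝ) + 1) * Real.log 2 ≤ 6 * Real.log n := by linarith
  calc 3 * (n : ℝ) * (2 * Nat.log 2 s + 1) * Real.log 2
      = 3 * n * ((2 * (Nat.log 2 s : ℝ) + 1) * Real.log 2) := by ring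
    _ ≤ 3 * n * (6 * Real.log n) := by gcongr
    _ = _ := by ring

/-- Planar drawings are transported along graph isomorphisms. -/
theorem IsPlanarStraightLineDrawing.comp_iso {V W : Type*} {G : SimpleGraph V} {H : SimpleGraph W}
    {f : W → ℝ × ℝ} (hf : IsPlanarStraightLineDrawing H f) (e : G ≃g H) :
    IsPlanarStraightLineDrawing G (f ∘ e) where
  injective := hf.injective.comp e.injective
  vertex_edge u v w huv hw :=
    (hf.vertex_edge _ _ _ (e.map_rel_iff.2 huv) hw).imp (fun h => e.injective h)
      (fun h => e.injective h)
  edge_edge u v x y huv hxy hne :=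
    hf.edge_edge _ _ _ _ (e.map_rel_iff.2 huv) (e.map_rel_iff.2 hxy) fun h =>
      hne (Sym2.map.injective e.injective (by simpa using h))

theorem mainTheorem2 :
    ∃ U : ℕ → Finset (ℕ × ℕ),
      (∀ n : ℕ, IsUniversalPointSet (n := n) IsArrangementGraph
        (gridPoint '' (U n : Set (ℕ × ℕ)))) ∧
      (fun n : ℕ => ((U n).card : ℝ)) =O[atTop] (fun n : ℕ => (n : ℝ) * Real.log n) ∧
      ∀ n ℓ : ℕ, n = ℓ * (ℓ - 1) / 2 →
        U n ⊆ Finset.Icc 1 (kappaMax ℓ) ×ˢ Finset.Icc 1 (3 * (ℓ - 1) / 2) ∧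
        ∀ i ∈ Finset.Icc 1 (3 * (ℓ - 1) / 2),
          ((U n).filter fun p => p.2 = i).card = min (ℓ * xiSeq i) (kappaMax ℓ) := by
  refine ⟨fun n => arrangementPoints (numPseudolines n), ?_, card_arrangementPoints_isBigO, ?_⟩
  · rintro n G ⟨ℓ, L, hL, ⟨e⟩⟩
    obtain ⟨f, hf, hdraw⟩ := hL.exists_drawing
    -- The sweep is used here only to count the crossings, which identifies `n`.
    obtain ⟨-, -, s, -⟩ := hL.exists_sweep
    have hn : n = ℓ * (ℓ - 1) / 2 := by
      simpa using Fintype.card_congr (e.toEquiv.trans s)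
    subst hn
    refine ⟨f ∘ e, fun v => ?_, hdraw.comp_iso e⟩
    beta_reduce
    rw [arrangementPoints_numPseudolines]
    exact hf _
  · rintro _ ℓ rfl
    beta_reduce
    rw [arrangementPoints_numPseudolines]
    exact ⟨Finset.filter_subset _ _, fun i hi => card_filter_arrangementPoints hi⟩
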